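/- Let $k$ be a field of characteristic $p>0$ that is $F$-finite (i.e. $k$ is a finite extension of $k^p$), let $X$ and $Y$ be normal (integral) algebraic varieties over $k$, and let $\pi\colon Y\to X$ be a finite surjective $k$-morphism. Assume that $\pi$ is separable (the extension of function fields $K(X)\subseteq K(Y)$ is separable) and tamely ramified in codimension one: for every codimension one point $y\in Y$, the local inclusion of discrete valuation rings $\mathcal O_{X,\pi(y)}\subseteq\mathcal O_{Y,y}$ is generically finite and generically separable, has separable residue field extension, and has ramification index $n_y$ (the order of vanishing in $\mathcal O_{Y,y}$ of a local parameter of $\mathcal O_{X,\pi(y)}$) not divisible by $p$. Let $e\ge 1$ and let $F^e$ be the $e$-th iterate of the absolute Frobenius. For a nonzero $\psi\in\operatorname{Hom}_{\mathcal O_X}(F^e_*\mathcal O_X,\mathcal O_X)$ let $\Delta_\psi=\frac1{p^e-1}D_\psi$, where $D_\psi$ is the effective Weil divisor of zeros of $\psi$ as a section of the rank one reflexive $F^e_*\mathcal O_X$-module $\mathcal{H}om_{\mathcal O_X}(F^e_*\mathcal O_X,\mathcal O_X)\cong F^e_*\mathcal O_X((1-p^e)K_X)$; that is, at a codimension one point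 $x$ the coefficient of $D_\psi$ is $\operatorname{ord}_x(c)$, where $\psi_x(\cdot)=\Phi(c\,\cdot)$ with $c\in\mathcal O_{X,x}$ and $\Phi$ a generator of the $F^e_*\mathcal O_{X,x}$-module $\operatorname{Hom}_{\mathcal O_{X,x}}(F^e_*\mathcal O_{X,x},\mathcal O_{X,x})$; similarly on $Y$. Let $\mathrm{Ram}_\pi=\sum_y (n_y-1)\,\overline{\{y\}}$ be the ramification divisor of $\pi$, and let $\pi^*$ be the pullback of $\mathbb Q$-divisors, whose coefficient at $y$ is $n_y$ times the coefficient at $\pi(y)$. Then, for every nonzero $\psi\in\operatorname{Hom}_{\mathcal O_X}(F^e_*\mathcal O_X,\mathcal O_X)$, there exists $\bar\psi\in\operatorname{Hom}_{\mathcal O_Y}(F^e_*\mathcal O_Y,\mathcal O_Y)$ extending $\psi$ (i.e. $\bar\psi(\pi^\# a)=\pi^\#\psi(a)$ for all local sections $a$ of $\mathcal O_X$) if and only if $\pi^*\Delta_\psi\ge\mathrm{Ram}_\pi$. Furthermore, every $\bar\psi$ extending $\psi$ satisfies $\Delta_{\bar\psi}=\pi^*\Delta_\psi-\mathrm{Ram}_\pi$.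 -/

import Mathlib

open AlgebraicGeometry CategoryTheory

universe u

noncomputable section

/-! ### `p^{-e}`-linear maps on rings -/

/-- A `p^{-e}`-linear map on a commutative ring `R` of characteristic `p`: an additive map
`ψ : R → R` with `ψ (r ^ (p ^ e) * a) = r * ψ a`.  As `F^e_* R` is the additive group `R` on which
`r : R` acts as multiplication by `r ^ (p ^ e)`, these are exactly the elements of
`Hom_R(F^e_* R, R)` (equivalently of `Hom_R(R^{1/p^e}, R)`). -/
structure PInvLinearMap (p e : ℕ) (R : Type u) [CommRing R] extends R →+ R where
  map_pow_mul' : ∀ r a : R, toFun (r ^ (p ^ e) * a) = r * toFun a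

namespace PInvLinearMap

variable {p e : ℕ} {R : Type u} [CommRing R]

instance : FunLike (PInvLinearMap p e R) R R where
  coe ψ := ψ.toFun
  coe_injective ψ φ h := by
    cases ψ; cases φ; congr; exact DFunLike.coe_injective h

instance : AddMonoidHomClass (PInvLinearMap p e R) R R where
  map_add ψ := ψ.map_add'
  map_zero ψ := ψ.map_zero'

theorem map_pow_mul (ψ : PInvLinearMap p e R) (r a : R) : ψ (r ^ (p ^ e) * a) = r * ψ a :=
  ψ.map_pow_mul' r a

@[ext]
theorem ext {ψ φ : PInvLinearMap p e R} (h : ∀ a, ψ a = φ a) : ψ = φ :=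
  DFunLike.ext _ _ h

instance : Zero (PInvLinearMap p e R) where
  zero := { (0 : R →+ R) with map_pow_mul' := fun r a => by simp }

/-- `Hom_R(F^e_* R, R)` is a module over the ring `F^e_* R = R`: `c` acts by premultiplication,
`(c • Φ) a = Φ (c * a)`. -/
instance : SMul R (PInvLinearMap p e R) where
  smul c Φ :=
    { toFun := fun a => Φ (c * a)
      map_zero' := by simp
      map_add' := fun a b => by rw [mul_add, map_add]
      map_pow_mul' := fun r a => by rw [mul_left_comm, map_pow_mul] }

theorem smul_apply (c : R) (Φ : PInvLinearMap p e R) (a : R) : (c • Φ) a = Φ (c * a) := rfl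

/-- The order of vanishing of `ψ` as an element of the `F^e_* R`-module `Hom_R(F^e_* R, R)`, where
`R` is local with maximal ideal `m`: the largest `n` with `ψ = c • Φ` for some `c ∈ m ^ n` and some
`Φ` (and `⊤` if there is no largest one).  For `R` an `F`-finite discrete valuation ring the module
is free of rank one, and this is the valuation of `c` when `ψ = c • Φ` with `Φ` a generator, see
`PInvLinearMap.ord_smul_of_generator`. -/
def ord [IsLocalRing R] (ψ : PInvLinearMap p e R) : ℕ∞ :=
  ⨆ n ∈ {n : ℕ | ∃ c ∈ IsLocalRing.maximalIdeal R ^ n, ∃ Φ : PInvLinearMap p e R, ψ = c • Φ},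
    (n : ℕ∞)

theorem ord_smul_of_generator [IsDomain R] [IsDiscreteValuationRing R]
    (Φ : PInvLinearMap p e R) (hp : p ≠ 0) (hΦ : Φ ≠ 0) (hgen : ∀ ψ, ∃ c : R, ψ = c • Φ) (c : R) :
    (c • Φ).ord = IsDiscreteValuationRing.addVal R c := by
  have hfree : ∀ t : R, t • Φ = 0 → t = 0 := by
    intro t ht
    by_contra h0
    apply hΦ
    ext a
    have h1 : t * Φ a = 0 := by
      rw [← map_pow_mul]
      have h2 : t ^ (p ^ e) * a = t * (t ^ (p ^ e - 1) * a) := by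
        rw [← mul_assoc, mul_pow_sub_one (pow_ne_zero _ hp)]
      rw [h2, ← smul_apply, ht]
      rfl
    exact (mul_eq_zero.mp h1).resolve_left h0
  have hmem : ∀ (x : R) (n : ℕ), x ∈ IsLocalRing.maximalIdeal R ^ n ↔
      (n : ℕ∞) ≤ IsDiscreteValuationRing.addVal R x := by
    intro x n
    obtain ⟨ϖ, hϖ⟩ := IsDiscreteValuationRing.exists_irreducible R
    rw [hϖ.maximalIdeal_eq, Ideal.span_singleton_pow, Ideal.mem_span_singleton,
      ← IsDiscreteValuationRing.addVal_le_iff_dvd, IsDiscreteValuationRing.addVal_pow,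
      IsDiscreteValuationRing.addVal_uniformizer hϖ]
    simp
  have key : ∀ n : ℕ, (∃ d ∈ IsLocalRing.maximalIdeal R ^ n, ∃ Ψ : PInvLinearMap p e R,
      c • Φ = d • Ψ) ↔ (n : ℕ∞) ≤ IsDiscreteValuationRing.addVal R c := by
    intro n
    constructor
    · rintro ⟨d, hd, Ψ, h⟩
      obtain ⟨b, rfl⟩ := hgen Ψ
      have hc : c = b * d := by
        rw [← sub_eq_zero]
        apply hfree
        ext a
        have := DFunLike.congr_fun h a
        simp only [smul_apply] at this ⊢
        rw [sub_mul, map_sub, this, mul_assoc]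
        exact sub_self _
      rw [← hmem, hc]
      exact Ideal.mul_mem_left _ _ hd
    · intro h
      exact ⟨c, (hmem _ _).mpr h, Φ, rfl⟩
  rw [ord]
  simp only [Set.mem_ofPred_eq, key]
  apply le_antisymm
  · exact iSup₂_le fun n hn => hn
  · exact ENat.forall_natCast_le_iff_le.mp fun n hn => le_iSup₂_of_le n hn le_rfl

end PInvLinearMap

/-! ### `p^{-e}`-linear maps on schemes -/

/-- An element of `Hom_{O_X}(F^e_* O_X, O_X)`.  The `e`-th iterate `F^e` of the absolute Frobenius
is the identity on the space `X` and `a ↦ a ^ (p ^ e)` on sections, so this is a family of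
`p^{-e}`-linear maps `Γ(X, U) → Γ(X, U)` which is compatible with restriction. -/
structure PInvLinearMapScheme (p e : ℕ) (X : Scheme.{u}) where
  app (U : X.Opens) : PInvLinearMap p e Γ(X, U)
  app_res : ∀ {U V : X.Opens} (h : V ≤ U) (a : Γ(X, U)),
    app V ((X.presheaf.map (homOfLE h).op).hom a) = (X.presheaf.map (homOfLE h).op).hom (app U a)

namespace PInvLinearMapScheme

variable {p e : ℕ} {X Y : Scheme.{u}}

instance : Zero (PInvLinearMapScheme p e X) where
  zero := { app := fun _ => 0, app_res := fun _ _ => (map_zero _).symm }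

/-- The germ of `ψ(a)` at `x` depends only on the germ of `a`. -/
theorem germ_app_eq (ψ : PInvLinearMapScheme p e X) {x : X} {U V : X.Opens} (hU : x ∈ U)
    (hV : x ∈ V) (a : Γ(X, U)) (b : Γ(X, V))
    (h : (X.presheaf.germ U x hU).hom a = (X.presheaf.germ V x hV).hom b) :
    (X.presheaf.germ U x hU).hom (ψ.app U a) = (X.presheaf.germ V x hV).hom (ψ.app V b) := by
  obtain ⟨W, hW, iU, iV, e⟩ := X.presheaf.germ_eq x hU hV a b h
  have h1 := ψ.app_res iU.le a
  have h2 := ψ.app_res iV.le b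
  have e' : (X.presheaf.map (homOfLE iU.le).op).hom a =
      (X.presheaf.map (homOfLE iV.le).op).hom b := e
  rw [e', h2] at h1
  rw [← TopCat.Presheaf.germ_res_apply X.presheaf (homOfLE iU.le) x hW,
    ← TopCat.Presheaf.germ_res_apply X.presheaf (homOfLE iV.le) x hW]
  exact congrArg _ h1.symm

/-- Underlying function of `PInvLinearMapScheme.stalk`. -/
def stalkFun (ψ : PInvLinearMapScheme p e X) (x : X) (s : X.presheaf.stalk x) :
    X.presheaf.stalk x :=
  let h := X.presheaf.exists_germ_eq s
  (X.presheaf.germ h.choose x h.choose_spec.choose).hom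
    (ψ.app _ h.choose_spec.choose_spec.choose)

theorem stalkFun_germ (ψ : PInvLinearMapScheme p e X) {x : X} {U : X.Opens} (hU : x ∈ U)
    (a : Γ(X, U)) :
    ψ.stalkFun x ((X.presheaf.germ U x hU).hom a) = (X.presheaf.germ U x hU).hom (ψ.app U a) :=
  germ_app_eq ψ _ _ _ _
    (X.presheaf.exists_germ_eq ((X.presheaf.germ U x hU).hom a)).choose_spec.choose_spec.choose_spec

/-- The map `ψ_x` induced by `ψ` on the stalk at `x`. -/
def stalk (ψ : PInvLinearMapScheme p e X) (x : X) :
    PInvLinearMap p e (X.presheaf.stalk x) where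
  toFun := ψ.stalkFun x
  map_zero' := by
    have h := ψ.stalkFun_germ (x := x) (U := ⊤) trivial 0
    rwa [map_zero, map_zero, map_zero] at h
  map_add' s t := by
    obtain ⟨U, hU, a, rfl⟩ := X.presheaf.exists_germ_eq s
    obtain ⟨V, hV, b, rfl⟩ := X.presheaf.exists_germ_eq t
    have hW : x ∈ U ⊓ V := ⟨hU, hV⟩
    rw [← TopCat.Presheaf.germ_res_apply X.presheaf (homOfLE (inf_le_left : U ⊓ V ≤ U)) x hW a,
      ← TopCat.Presheaf.germ_res_apply X.presheaf (homOfLE (inf_le_right : U ⊓ V ≤ V)) x hW b]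
    erw [← map_add, stalkFun_germ, stalkFun_germ, stalkFun_germ, map_add, map_add]
  map_pow_mul' s t := by
    obtain ⟨U, hU, a, rfl⟩ := X.presheaf.exists_germ_eq s
    obtain ⟨V, hV, b, rfl⟩ := X.presheaf.exists_germ_eq t
    have hW : x ∈ U ⊓ V := ⟨hU, hV⟩
    rw [← TopCat.Presheaf.germ_res_apply X.presheaf (homOfLE (inf_le_left : U ⊓ V ≤ U)) x hW a,
      ← TopCat.Presheaf.germ_res_apply X.presheaf (homOfLE (inf_le_right : U ⊓ V ≤ V)) x hW b]
    erw [← map_pow, ← map_mul, stalkFun_germ, stalkFun_germ, PInvLinearMap.map_pow_mul, map_mul]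

theorem stalk_germ (ψ : PInvLinearMapScheme p e X) {x : X} {U : X.Opens} (hU : x ∈ U)
    (a : Γ(X, U)) :
    ψ.stalk x ((X.presheaf.germ U x hU).hom a) = (X.presheaf.germ U x hU).hom (ψ.app U a) :=
  ψ.stalkFun_germ hU a

/-- `ψY` on `Y` extends `ψ` on `X` along `π : Y ⟶ X`: the maps commute with
`π^# : O_X → π_* O_Y`. -/
def Extends (π : Y ⟶ X) (ψ : PInvLinearMapScheme p e X) (ψY : PInvLinearMapScheme p e Y) : Prop :=
  ∀ (U : X.Opens) (a : Γ(X, U)),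
    ψY.app (π ⁻¹ᵁ U) ((π.app U).hom a) = (π.app U).hom (ψ.app U a)

end PInvLinearMapScheme

/-! ### Divisors -/

/-- The prime divisors of a scheme, given by their generic points: the points of codimension
one. -/
def PrimeDivisor (X : Scheme.{u}) : Type u := {x : X // Order.coheight x = 1}

/-- `ℚ`-divisors, given by their coefficients along the prime divisors; the order, addition and
subtraction are coefficientwise. -/
abbrev QDivisor (X : Scheme.{u}) : Type u := PrimeDivisor X → ℚ

/-- The `ℚ`-divisor `Δ_ψ = D_ψ / (p ^ e - 1)`, where `D_ψ` is the divisor of zeros of `ψ` as a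
section of the rank one reflexive `F^e_* O_X`-module `Hom_{O_X}(F^e_* O_X, O_X)`, isomorphic to
`F^e_* O_X((1 - p ^ e) K_X)`. It is meant for `ψ ≠ 0`, and then all the orders are finite. -/
def PInvLinearMapScheme.divisor {p e : ℕ} {X : Scheme.{u}} (ψ : PInvLinearMapScheme p e X) :
    QDivisor X :=
  fun x => ((ψ.stalk x.1).ord.toNat : ℚ) / ((p : ℚ) ^ e - 1)

/-- For a local homomorphism `φ : R → S` of discrete valuation rings, the order of vanishing in `S`
of a local parameter of `R`. -/
def ramificationIndex {R S : Type u} [CommRing R] [CommRing S] [IsLocalRing R] [IsLocalRing S]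
    (φ : R →+* S) : ℕ :=
  sSup {n : ℕ | (IsLocalRing.maximalIdeal R).map φ ≤ IsLocalRing.maximalIdeal S ^ n}

/-- The pullback `π^* D` of a `ℚ`-divisor along a finite surjective morphism `π` of normal
varieties: the coefficient at `y` is the ramification index at `y` times the coefficient of `D`
at `π y`.  (For such `π` the point `π y` always has codimension one.) -/
def QDivisor.pullback {X Y : Scheme.{u}} (π : Y ⟶ X) (D : QDivisor X) : QDivisor Y :=
  fun y => if h : Order.coheight (π y.1) = 1 then
    (ramificationIndex (π.stalkMap y.1).hom : ℚ) * D ⟨π y.1, h⟩ else 0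

/-- The ramification divisor of a morphism that is tamely ramified in codimension one: the
coefficient at `y` is `n - 1`, where `n` is the ramification index at `y`. -/
def ramificationDivisor {X Y : Scheme.{u}} (π : Y ⟶ X) : QDivisor Y :=
  fun y => (ramificationIndex (π.stalkMap y.1).hom : ℚ) - 1

/-! ### Varieties, separability and tame ramification -/

/-- `X`, with structure morphism `s`, is a normal algebraic variety over the field `k`. -/
structure IsNormalVariety {k : Type u} [Field k] {X : Scheme.{u}} (s : X ⟶ Spec (.of k)) :
    Prop where
  isIntegral : IsIntegral X
  isSeparated : IsSeparated s
  locallyOfFiniteType : LocallyOfFiniteType s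
  quasiCompact : QuasiCompact s
  normal : ∀ x : X, IsIntegrallyClosed (X.presheaf.stalk x)

/-- The ring homomorphism `φ` makes the target separable (algebraic) over the source; used for
extensions of fields. -/
def RingHom.IsSeparableExt {K L : Type u} [CommRing K] [CommRing L] (φ : K →+* L) : Prop :=
  @Algebra.IsSeparable K L _ _ φ.toAlgebra

/-- The dominant morphism `π : Y ⟶ X` of integral schemes is separable: the extension of function
fields, given by the stalk map at the generic point of `Y`, is separable. -/
def IsSeparableMorphism {X Y : Scheme.{u}} [IsIntegral Y] (π : Y ⟶ X) : Prop :=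
  (π.stalkMap (genericPoint Y)).hom.IsSeparableExt

/-- A local homomorphism of discrete valuation rings is a tamely ramified inclusion. -/
structure IsTamelyRamified (p : ℕ) {R S : Type u} [CommRing R] [CommRing S] [IsDomain R]
    [IsDomain S] [IsLocalRing R] [IsLocalRing S] (φ : R →+* S) [IsLocalHom φ] : Prop where
  injective : Function.Injective φ
  generically_finite :
    (IsFractionRing.map injective : FractionRing R →+* FractionRing S).Finite
  generically_separable :
    (IsFractionRing.map injective : FractionRing R →+* FractionRing S).IsSeparableExt
  residueField_separable : (IsLocalRing.ResidueField.map φ).IsSeparableExt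
  not_dvd_ramificationIndex : ¬ p ∣ ramificationIndex φ

/-- `π : Y ⟶ X` is tamely ramified in codimension one: at every codimension one point `y` of `Y`,
the local homomorphism `O_{X, π y} → O_{Y, y}` is tamely ramified. -/
def IsTamelyRamifiedInCodimOne (p : ℕ) {X Y : Scheme.{u}} [IsIntegral X] [IsIntegral Y]
    (π : Y ⟶ X) : Prop :=
  ∀ y : PrimeDivisor Y, IsTamelyRamified p (π.stalkMap y.1).hom

end

noncomputable section

/-! The heart is a computation for a tame extension `R → S` of discrete valuation rings with
uniformizers t, u, where t = w u^n with w a unit. Let Ψ be a p^{-e}-linear map on `L = Frac S`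
restricting to ψ on `R`, and let v = ord ψ. Then Ψ sends u^{-N} S into S exactly when N ≤ n v - (p^e
- 1)(n - 1) (`PInvLinearMap.map_zpowSpan_iff`). With N = 0 this decides whether Ψ preserves S; with
all N ≥ 0 it gives the order of Ψ restricted to S.

Premultiplying Ψ by t^{p^e - 1 - v} reduces the computation to order exactly p^e - 1, that is, Δ
with coefficient 1. This is the fixed value of tame pullback, since n·1 - (n - 1) = 1. The twisted
map Ψ' preserves R and tR and takes a unit value on R, and the point is that Ψ'(uS) ⊆ uS
(`PInvLinearMap.map_mem_zpowSpan_min`). As n is prime to p and the residue extension is separable,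
every element of u^j S is, modulo u^{j+1} S, a sum of terms t^a (u^b)^{p^e} φ(r) z^{p^e} with n a +
p^e b = j. On such terms Ψ' is determined by its values on R. Descending induction on j finishes,
starting from a common denominator for Ψ.

Globally, separability of the function fields extends ψ to a map Ψ on `K(Y)`. The local result and
the numerical condition show that Ψ preserves the stalks at codimension one points. As Y is normal,
its sections are the rational functions regular in codimension one, so Ψ preserves all sections.
Conversely, the divisor formula exhibits π^*Δ_ψ - Ram_π as the divisor of an extension, which is
effective. -/

/-! ### Separable residue fields and the arithmetic of exponents. -/

theorem IsSeparable.mem_closure_mul_pow {K L : Type*} [Field K] [Field L] [Algebra K L]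
    [Algebra.IsSeparable K L] (p e : ℕ) [ExpChar K p] (x : L) :
    x ∈ AddSubgroup.closure {y : L | ∃ (c : K) (z : L), y = algebraMap K L c * z ^ p ^ e} := by
  have h : Submodule.span K (Set.range (id : L → L)) = ⊤ := by simp
  have h2 := Field.span_map_pow_expChar_pow_eq_top_of_isSeparable p e h
  have hx : x ∈ Submodule.span K (Set.range ((id : L → L) · ^ p ^ e)) := h2 ▸ trivial
  induction hx using Submodule.closure_induction with
  | zero => exact zero_mem _
  | add x y _ _ hx hy => exact add_mem hx hy
  | smul_mem r x hx =>
    obtain ⟨z, rfl⟩ := hx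
    exact AddSubgroup.subset_closure ⟨r, z, Algebra.smul_def _ _⟩

/-- Separability of the residue fields, λ over κ, gives λ = κ·λ^{p^e}, and generators lift along the
residue maps. An additive closure suffices because p^{-e}-linear maps are additive and are computed
on each generator. -/
theorem IsLocalRing.exists_mem_closure_mul_pow_sub_mem {R S : Type u} [CommRing R] [CommRing S]
    [IsLocalRing R] [IsLocalRing S] (φ : R →+* S) [IsLocalHom φ] (p e : ℕ)
    [ExpChar (IsLocalRing.ResidueField R) p]
    (hsep : (IsLocalRing.ResidueField.map φ).IsSeparableExt) (s : S) :
    ∃ x ∈ AddSubgroup.closure {x : S | ∃ (r : R) (z : S), x = φ r * z ^ p ^ e},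
      s - x ∈ IsLocalRing.maximalIdeal S := by
  let := (IsLocalRing.ResidueField.map φ).toAlgebra
  have : Algebra.IsSeparable (IsLocalRing.ResidueField R) (IsLocalRing.ResidueField S) := hsep
  have h := IsSeparable.mem_closure_mul_pow (K := IsLocalRing.ResidueField R) p e
    (IsLocalRing.residue S s)
  have key : AddSubgroup.closure {y : IsLocalRing.ResidueField S |
      ∃ (c : IsLocalRing.ResidueField R) (z : IsLocalRing.ResidueField S),
        y = algebraMap _ _ c * z ^ p ^ e} ≤
      (AddSubgroup.closure {x : S | ∃ (r : R) (z : S), x = φ r * z ^ p ^ e}).map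
        (IsLocalRing.residue S).toAddMonoidHom := by
    rw [AddSubgroup.closure_le]
    rintro y ⟨c, z, rfl⟩
    obtain ⟨r, rfl⟩ := IsLocalRing.residue_surjective c
    obtain ⟨z, rfl⟩ := IsLocalRing.residue_surjective z
    refine ⟨_, AddSubgroup.subset_closure ⟨r, z, rfl⟩, ?_⟩
    change IsLocalRing.residue S _ = _
    rw [map_mul, map_pow]
    rfl
  obtain ⟨x, hx, hxs⟩ := key h
  refine ⟨x, hx, ?_⟩
  rw [← IsLocalRing.residue_eq_zero_iff, map_sub, sub_eq_zero]
  exact hxs.symm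

/-- Used with q = p^e to split u^j into t^a times the p^e-th power of u^b. Taking 0 ≤ a < q gives
the inequality: if a = 0 then q b = j, and if a > 0 then q (b + n) = j + n (q - a) > 0. -/
theorem exists_natCast_mul_add_mul_eq {n q : ℕ} (hq : 0 < q) (hn : 0 < n) (h : n.Coprime q)
    (j : ℕ) : ∃ (a : ℕ) (b : ℤ), (n : ℤ) * a + q * b = j ∧
      ((min j 1 : ℕ) : ℤ) ≤ b + n * (min a 1 : ℕ) := by
  obtain ⟨x, hx⟩ : ∃ x : ℤ, (q : ℤ) ∣ j - n * x := by
    have h1 : IsCoprime (n : ℤ) q := Nat.isCoprime_iff_coprime.mpr h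
    obtain ⟨c, d, hcd⟩ := h1
    exact ⟨c * j, d * j, by linear_combination (-(j : ℤ)) * hcd⟩
  have hq' : (0 : ℤ) < q := by exact_mod_cast hq
  have hx0 := Int.emod_nonneg x hq'.ne'
  have hxq := Int.emod_lt_of_pos x hq'
  obtain ⟨a, ha⟩ := Int.eq_ofNat_of_zero_le hx0
  have : (q : ℤ) ∣ j - n * a := by
    have h2 := Int.emod_add_mul_ediv x q
    rw [ha] at h2
    have : (j : ℤ) - n * a = (j - n * x) + q * (n * (x / q)) := by
      linear_combination (-(n : ℤ)) * h2
    rw [this]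
    exact dvd_add hx (dvd_mul_right _ _)
  obtain ⟨b, hb⟩ := this
  rw [ha] at hxq
  refine ⟨a, b, by linarith, ?_⟩
  rcases Nat.eq_zero_or_pos a with rfl | ha0
  · rcases Nat.eq_zero_or_pos j with rfl | hj
    · have : b = 0 := by
        have : (q : ℤ) * b = 0 := by simpa using hb.symm
        exact (mul_eq_zero.mp this).resolve_left hq'.ne'
      simp [this]
    · have hj' : (0 : ℤ) < j := by exact_mod_cast hj
      have : 0 < (q : ℤ) * b := by simpa [← hb] using hj'
      have hb0 : 0 < b := pos_of_mul_pos_right this hq'.le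
      rw [min_eq_right (show 1 ≤ j from hj)]
      simpa using Int.add_one_le_iff.mpr hb0
  · have h3 : 0 < (q : ℤ) * (b + n) := by
      rw [mul_add, ← hb]
      have hn' : (0 : ℤ) < n := by exact_mod_cast hn
      have : (n : ℤ) * (a + 1) ≤ n * q := by
        apply mul_le_mul_of_nonneg_left _ hn'.le
        omega
      have : (0 : ℤ) ≤ j := by positivity
      nlinarith
    have hb0 : 0 < b + n := pos_of_mul_pos_right h3 hq'.le
    rw [min_eq_right (show 1 ≤ a from ha0)]
    have : ((min j 1 : ℕ) : ℤ) ≤ 1 := by exact_mod_cast min_le_right j 1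
    push_cast at *
    omega

/-! ### The order of a p^{-e}-linear map on a discrete valuation ring. -/

namespace PInvLinearMap

variable {p e : ℕ} {R : Type u} [CommRing R]

theorem natCast_le_ord_iff_exists [IsLocalRing R] (ψ : PInvLinearMap p e R) (n : ℕ) :
    (n : ℕ∞) ≤ ψ.ord ↔
      ∃ c ∈ IsLocalRing.maximalIdeal R ^ n, ∃ Φ : PInvLinearMap p e R, ψ = c • Φ := by
  constructor
  · intro h
    by_contra hn
    have hlt : ∀ m : ℕ, (∃ c ∈ IsLocalRing.maximalIdeal R ^ m, ∃ Φ : PInvLinearMap p e R,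
        ψ = c • Φ) → m < n := by
      rintro m ⟨c, hc, Φ, hΦ⟩
      by_contra! hm
      exact hn ⟨c, Ideal.pow_le_pow_right hm hc, Φ, hΦ⟩
    -- The exponent 0 always occurs, with c = 1, so n - 1 below is not truncated.
    have h0 : 0 < n := hlt 0 ⟨1, by simp, ψ, by ext; simp [smul_apply]⟩
    have hle : ψ.ord ≤ ((n - 1 : ℕ) : ℕ∞) :=
      iSup₂_le fun m hm => by exact_mod_cast Nat.le_sub_one_of_lt (hlt m hm)
    have := h.trans hle
    norm_cast at this
    omega
  · intro h
    exact le_iSup₂_of_le n h le_rfl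

/-- If ψ = t^n • Φ, then t^n Φ(r) = Φ(t^{n p^e} r) = ψ(t^{n (p^e - 1)} r). So Φ is forced, and it
exists as soon as these values are divisible by t^n. No generator of the module of p^{-e}-linear
maps is needed. -/
theorem natCast_le_ord_iff [IsDomain R] [IsDiscreteValuationRing R] (hp : p ≠ 0) {t : R}
    (ht : Irreducible t) (ψ : PInvLinearMap p e R) (n : ℕ) :
    (n : ℕ∞) ≤ ψ.ord ↔ ∀ r, t ^ n ∣ ψ (t ^ (n * (p ^ e - 1)) * r) := by
  have hq : 0 < p ^ e := pow_pos (Nat.pos_of_ne_zero hp) e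
  rw [natCast_le_ord_iff_exists, ht.maximalIdeal_eq, Ideal.span_singleton_pow]
  constructor
  · rintro ⟨c, hc, Φ, rfl⟩ r
    obtain ⟨d, rfl⟩ := Ideal.mem_span_singleton.mp hc
    refine ⟨Φ (d * r), ?_⟩
    rw [smul_apply, ← map_pow_mul]
    congr 1
    obtain ⟨m, hm⟩ : ∃ m, p ^ e = m + 1 := ⟨p ^ e - 1, by omega⟩
    rw [hm]
    simp only [Nat.add_sub_cancel]
    ring
  · intro h
    choose f hf using h
    have h0 : t ^ n ≠ 0 := pow_ne_zero _ ht.ne_zero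
    refine ⟨t ^ n, Ideal.mem_span_singleton_self _,
      { toFun := f
        map_zero' := mul_left_cancel₀ h0 (by rw [← hf]; simp)
        map_add' := fun a b => mul_left_cancel₀ h0 (by
          rw [← hf, mul_add, map_add, hf, hf, mul_add])
        map_pow_mul' := fun r a => mul_left_cancel₀ h0 (by
          rw [← hf, mul_left_comm, map_pow_mul, hf, mul_left_comm]) }, ?_⟩
    ext a
    apply mul_left_cancel₀ h0
    change _ = t ^ n * f _
    rw [← hf, ← map_pow_mul]
    congr 1
    obtain ⟨m, hm⟩ : ∃ m, p ^ e = m + 1 := ⟨p ^ e - 1, by omega⟩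
    rw [hm]
    simp only [Nat.add_sub_cancel]
    ring

/-- Order at least m p^e lets the factor t^m come out of ψ, so infinite order would make every value
divisible by all powers of t. -/
theorem ord_ne_top [IsDomain R] [IsDiscreteValuationRing R]
    {ψ : PInvLinearMap p e R} (hψ : ψ ≠ 0) : ψ.ord ≠ ⊤ := by
  intro h
  apply hψ
  obtain ⟨t, ht⟩ := IsDiscreteValuationRing.exists_irreducible R
  have key : ∀ (m : ℕ) (r : R), t ^ m ∣ ψ r := by
    intro m r
    have h1 : ((m * p ^ e : ℕ) : ℕ∞) ≤ ψ.ord := h ▸ le_top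
    rw [natCast_le_ord_iff_exists, ht.maximalIdeal_eq, Ideal.span_singleton_pow] at h1
    obtain ⟨c, hc, Φ, rfl⟩ := h1
    obtain ⟨d, rfl⟩ := Ideal.mem_span_singleton.mp hc
    refine ⟨Φ (d * r), ?_⟩
    rw [smul_apply, ← map_pow_mul, ← pow_mul, mul_assoc]
  ext r
  by_contra hr
  change ψ r ≠ 0 at hr
  obtain ⟨m, u, hu⟩ := IsDiscreteValuationRing.eq_unit_mul_pow_irreducible hr ht
  have h1 := key (m + 1) r
  rw [hu, Units.dvd_mul_left, pow_dvd_pow_iff ht.ne_zero ht.not_isUnit] at h1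
  omega

end PInvLinearMap

/-! ### Fractional powers of a principal ideal -/

/-- The `S`-submodule of `L` generated by `ϖ ^ m`, where `m` may be negative. -/
def zpowSpan (S : Type*) {L : Type*} [CommRing S] [Field L] [Algebra S L] (ϖ : L) (m : ℤ) :
    Submodule S L :=
  Submodule.span S {ϖ ^ m}

section zpowSpan

variable {S L : Type*} [CommRing S] [Field L] [Algebra S L] {ϖ : L} {m k : ℤ} {x y : L}

theorem mem_zpowSpan : x ∈ zpowSpan S ϖ m ↔ ∃ s : S, x = ϖ ^ m * algebraMap S L s := by
  rw [zpowSpan, Submodule.mem_span_singleton]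
  refine exists_congr fun s => ?_
  rw [Algebra.smul_def, mul_comm, eq_comm]

theorem mem_zpowSpan_zero : x ∈ zpowSpan S ϖ 0 ↔ ∃ s : S, x = algebraMap S L s := by
  simp [mem_zpowSpan]

theorem zpow_mem_zpowSpan : ϖ ^ m ∈ zpowSpan S ϖ m := mem_zpowSpan.mpr ⟨1, by simp⟩

theorem algebraMap_mem_zpowSpan (s : S) : algebraMap S L s ∈ zpowSpan S ϖ 0 :=
  mem_zpowSpan_zero.mpr ⟨s, rfl⟩

theorem mul_mem_zpowSpan (hϖ : ϖ ≠ 0) (hx : x ∈ zpowSpan S ϖ m) (hy : y ∈ zpowSpan S ϖ k) :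
    x * y ∈ zpowSpan S ϖ (m + k) := by
  obtain ⟨s, rfl⟩ := mem_zpowSpan.mp hx
  obtain ⟨s', rfl⟩ := mem_zpowSpan.mp hy
  exact mem_zpowSpan.mpr ⟨s * s', by rw [zpow_add₀ hϖ, map_mul]; ring⟩

theorem zpowSpan_antitone {u : S} (hu : algebraMap S L u ≠ 0) (h : m ≤ k) :
    zpowSpan S (algebraMap S L u) k ≤ zpowSpan S (algebraMap S L u) m := by
  intro x hx
  obtain ⟨s, rfl⟩ := mem_zpowSpan.mp hx
  obtain ⟨d, rfl⟩ := Int.le.dest h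
  exact mem_zpowSpan.mpr ⟨u ^ d * s, by rw [zpow_add₀ hu, map_mul, map_pow, zpow_natCast]; ring⟩

end zpowSpan

/-! ### The local computation along a tame extension. -/

namespace PInvLinearMap

variable {p e : ℕ} {R S L : Type u} [CommRing R] [CommRing S] [Field L] [Algebra S L]

/-- Only j = 1 is wanted, but the descending induction passes through all j. The leading term of an
element of u^j S is governed by the values of Ψ on R, while the remainder lies in u^{j+1} S. The
bound M provides the start. -/
theorem map_mem_zpowSpan_min (Ψ : PInvLinearMap p e L) (φ : R →+* S) {t : R} {u w : S} {n : ℕ}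
    (hp : p ≠ 0) (hw : IsUnit w) (ht : φ t = w * u ^ n) (hu : algebraMap S L u ≠ 0) (hn : 0 < n)
    (hcop : n.Coprime (p ^ e))
    (hres : ∀ s : S, ∃ x ∈ AddSubgroup.closure {x : S | ∃ (r : R) (z : S), x = φ r * z ^ p ^ e},
      ∃ s', s = x + u * s')
    (h0 : ∀ r, Ψ (algebraMap S L (φ r)) ∈ zpowSpan S (algebraMap S L u) 0)
    (h1 : ∀ r, Ψ (algebraMap S L (φ (t * r))) ∈ zpowSpan S (algebraMap S L u) n)
    (M : ℕ) (hM : ∀ x ∈ zpowSpan S (algebraMap S L u) M, Ψ x ∈ zpowSpan S (algebraMap S L u) 1)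
    (j : ℕ) (x : L) (hx : x ∈ zpowSpan S (algebraMap S L u) j) :
    Ψ x ∈ zpowSpan S (algebraMap S L u) (min j 1 : ℕ) := by
  have hq : 0 < p ^ e := pow_pos (Nat.pos_of_ne_zero hp) e
  have main : ∀ i j : ℕ, M ≤ j + i → ∀ x ∈ zpowSpan S (algebraMap S L u) j,
      Ψ x ∈ zpowSpan S (algebraMap S L u) (min j 1 : ℕ) := by
    intro i
    induction i with
    | zero =>
      intro j hj x hx
      refine zpowSpan_antitone hu ?_ (hM x (zpowSpan_antitone hu ?_ hx))
      · exact_mod_cast min_le_right j 1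
      · exact_mod_cast hj
    | succ i ih =>
      intro j hj x hx
      obtain ⟨s, rfl⟩ := mem_zpowSpan.mp hx
      obtain ⟨a, b, hab, hb⟩ := exists_natCast_mul_add_mul_eq hq hn hcop j
      -- Since t^a (u^b)^{p^e} = w^a u^j, the coefficient s is divided by w^a before it is
      -- approximated modulo u.
      obtain ⟨w, rfl⟩ := hw
      obtain ⟨y, hy, s', hs'⟩ := hres (((w ^ a)⁻¹ : Sˣ) * s)
      set ϖ := algebraMap S L u with hϖ
      have hτ : algebraMap S L (φ t) ^ a * (ϖ ^ b) ^ p ^ e =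
          algebraMap S L ((w ^ a : Sˣ) : S) * ϖ ^ (j : ℤ) := by
        rw [ht, ← hab, zpow_add₀ hu, zpow_mul, zpow_mul, map_mul, mul_pow, map_pow, ← hϖ,
          zpow_natCast, zpow_natCast, zpow_natCast, ← zpow_natCast (ϖ ^ b), zpow_comm, zpow_natCast,
          ← mul_assoc]
        simp
      have hw1 : algebraMap S L ((w ^ a : Sˣ) : S) * algebraMap S L (((w ^ a)⁻¹ : Sˣ) * s) =
          algebraMap S L s := by
        rw [← map_mul, ← mul_assoc, Units.mul_inv, one_mul]
      have hx2 : ϖ ^ (j : ℤ) * algebraMap S L s =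
          (ϖ ^ b) ^ p ^ e * (algebraMap S L (φ t) ^ a * algebraMap S L y) +
            ϖ ^ ((j + 1 : ℕ) : ℤ) * algebraMap S L ((w ^ a : Sˣ) * s') := by
        have h2 : ϖ ^ (j : ℤ) * algebraMap S L s =
            (algebraMap S L (φ t) ^ a * (ϖ ^ b) ^ p ^ e) *
              algebraMap S L (((w ^ a)⁻¹ : Sˣ) * s) := by
          rw [hτ, ← hw1]; ring
        have h3 : ϖ ^ ((j + 1 : ℕ) : ℤ) = ϖ ^ (j : ℤ) * ϖ := by
          rw [Nat.cast_succ, zpow_add₀ hu, zpow_one]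
        rw [h2, hs', map_add, mul_add, map_mul, map_mul, h3, hτ, ← hϖ, ← mul_assoc _ _ (algebraMap S L y),
          mul_comm ((ϖ ^ b) ^ p ^ e), hτ]
        ring
      rw [hx2, map_add, map_pow_mul]
      refine add_mem ?_ ?_
      · have h4 : Ψ (algebraMap S L (φ t) ^ a * algebraMap S L y) ∈
            zpowSpan S ϖ ((n : ℤ) * (min a 1 : ℕ)) := by
          clear hs' hx2
          induction hy using AddSubgroup.closure_induction with
          | zero => simp
          | add x y _ _ hx hy => rw [map_add, mul_add, map_add]; exact add_mem hx hy
          | neg x _ hx => rw [map_neg, mul_neg, map_neg]; exact neg_mem hx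
          | mem y hy =>
            obtain ⟨r, z, rfl⟩ := hy
            have h5 : algebraMap S L (φ t) ^ a * algebraMap S L (φ r * z ^ p ^ e) =
                algebraMap S L z ^ p ^ e * algebraMap S L (φ (t ^ a * r)) := by
              simp only [map_mul, map_pow]; ring
            rw [h5, map_pow_mul, ← Algebra.smul_def]
            apply Submodule.smul_mem
            -- A single factor t already yields u^n through `h1`; larger a gives no better bound,
            -- hence the minimum with 1.
            rcases Nat.eq_zero_or_pos a with rfl | ha
            · simpa using h0 r
            · obtain ⟨a, rfl⟩ := Nat.exists_eq_succ_of_ne_zero ha.ne'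
              rw [pow_succ', mul_assoc, min_eq_right ha]
              simpa using h1 (t ^ a * r)
        exact zpowSpan_antitone hu hb (mul_mem_zpowSpan hu zpow_mem_zpowSpan h4)
      · have h6 := ih (j + 1) (by omega) (ϖ ^ ((j + 1 : ℕ) : ℤ) * algebraMap S L ((w ^ a : Sˣ) * s'))
          (mem_zpowSpan.mpr ⟨_, rfl⟩)
        refine zpowSpan_antitone hu ?_ h6
        norm_cast
        omega
  exact main M j (by omega) x hx

end PInvLinearMap

namespace PInvLinearMap

variable {p e : ℕ} {R S L : Type u} [CommRing R] [CommRing S] [Field L] [Algebra S L]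

theorem map_zpow_mul (Ψ : PInvLinearMap p e L) (y : L) (m : ℤ) (x : L) :
    Ψ (y ^ ((p ^ e : ℕ) * m) * x) = y ^ m * Ψ x := by
  rw [← map_pow_mul, ← zpow_natCast (y ^ m), ← zpow_mul, mul_comm m]

/-- How an extension of a `p^{-e}`-linear map behaves along a tamely ramified extension of discrete
valuation rings with ramification index `n`. -/
theorem map_zpowSpan_iff [IsDomain R] [IsDiscreteValuationRing R] [IsDomain S] [IsLocalRing S]
    [IsFractionRing S L] (Ψ : PInvLinearMap p e L) (ψ : PInvLinearMap p e R) (φ : R →+* S)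
    [IsLocalHom φ]
    (hΨ : ∀ r, Ψ (algebraMap S L (φ r)) = algebraMap S L (φ (ψ r)))
    {t : R} {u w : S} {n v : ℕ} (hp : p ≠ 0) (htirr : Irreducible t) (huirr : Irreducible u)
    (hw : IsUnit w) (ht : φ t = w * u ^ n) (hn : 0 < n) (hcop : n.Coprime (p ^ e))
    (hres : ∀ s : S, ∃ x ∈ AddSubgroup.closure {x : S | ∃ (r : R) (z : S), x = φ r * z ^ p ^ e},
      ∃ s', s = x + u * s')
    (M : ℕ) (hM : ∀ x ∈ zpowSpan S (algebraMap S L u) M,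
      Ψ x ∈ zpowSpan S (algebraMap S L u) 0)
    (hv : ψ.ord = v) (N : ℤ) :
    (∀ x ∈ zpowSpan S (algebraMap S L u) (-N), Ψ x ∈ zpowSpan S (algebraMap S L u) 0) ↔
      N ≤ n * v - ((p : ℤ) ^ e - 1) * (n - 1) := by
  have hq : 0 < p ^ e := pow_pos (Nat.pos_of_ne_zero hp) e
  obtain ⟨q, hq'⟩ : ∃ q, p ^ e = q + 1 := ⟨p ^ e - 1, by omega⟩
  have hqz : (p : ℤ) ^ e = q + 1 := by exact_mod_cast hq'
  have hu : algebraMap S L u ≠ 0 := by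
    simpa using huirr.ne_zero
  have hw0 : algebraMap S L w ≠ 0 := by
    simpa using hw.ne_zero
  set ϖ := algebraMap S L u with hϖ
  set τ := algebraMap S L (φ t) with hτ
  have hτϖ : τ = algebraMap S L w * ϖ ^ n := by rw [hτ, ht, map_mul, map_pow]
  have hτ0 : τ ≠ 0 := by rw [hτϖ]; exact mul_ne_zero hw0 (pow_ne_zero _ hu)
  have hτmem : ∀ m : ℤ, τ ^ m ∈ zpowSpan S ϖ (n * m) := by
    intro m
    obtain ⟨w, rfl⟩ := hw
    refine mem_zpowSpan.mpr ⟨((w ^ m : Sˣ) : S), ?_⟩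
    rw [hτϖ, mul_zpow, mul_comm, zpow_mul, zpow_natCast]
    congr 1
    rw [← MonoidHom.coe_coe (algebraMap S L), ← Units.coe_map, ← Units.coe_map, map_zpow,
      Units.val_zpow_eq_zpow_val]
  have hdvd : ∀ r, t ^ v ∣ ψ (t ^ (v * q) * r) := by
    have := (natCast_le_ord_iff hp htirr ψ v).mp hv.ge
    simpa [hq'] using this
  obtain ⟨r₀, hr₀⟩ : ∃ r, ¬ t ^ (v + 1) ∣ ψ (t ^ ((v + 1) * q) * r) := by
    have h1 : ¬ ((v + 1 : ℕ) : ℕ∞) ≤ ψ.ord := by rw [hv]; norm_cast; omega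
    rw [natCast_le_ord_iff hp htirr] at h1
    simpa [hq'] using h1
  -- Here q = p^e - 1. The twist normalizes the order on R to p^e - 1: Ψ' will preserve R and tR,
  -- with a unit value at `r₀`.
  set Ψ' : PInvLinearMap p e L := τ ^ ((q : ℤ) - v) • Ψ with hΨ'
  -- values of the twisted map on `R`
  have hval : ∀ r, Ψ' (algebraMap S L (φ r)) =
      τ ^ (-(v : ℤ)) * algebraMap S L (φ (ψ (t ^ ((v + 1) * q) * r))) := by
    intro r
    rw [hΨ', smul_apply, ← hΨ, ← map_zpow_mul Ψ, map_mul φ,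
      map_mul (algebraMap S L), map_pow φ, map_pow (algebraMap S L), ← hτ,
      ← mul_assoc, ← zpow_natCast τ ((v + 1) * q), ← zpow_add₀ hτ0]
    congr 3
    rw [hq']
    push_cast
    ring
  have hint : ∀ r, ∃ c, ψ (t ^ ((v + 1) * q) * r) = t ^ v * c := by
    intro r
    obtain ⟨c, hc⟩ := hdvd (t ^ q * r)
    refine ⟨c, ?_⟩
    rw [← hc]
    congr 1
    ring
  have hval' : ∀ r c, ψ (t ^ ((v + 1) * q) * r) = t ^ v * c →
      Ψ' (algebraMap S L (φ r)) = algebraMap S L (φ c) := by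
    intro r c h
    rw [hval, h, map_mul, map_mul, map_pow, map_pow, ← hτ, ← mul_assoc, ← zpow_natCast τ v,
      ← zpow_add₀ hτ0, neg_add_cancel, zpow_zero, one_mul]
  have h0 : ∀ r, Ψ' (algebraMap S L (φ r)) ∈ zpowSpan S ϖ 0 := by
    intro r
    obtain ⟨c, hc⟩ := hint r
    rw [hval' r c hc]
    exact algebraMap_mem_zpowSpan _
  have h1 : ∀ r, Ψ' (algebraMap S L (φ (t * r))) ∈ zpowSpan S ϖ n := by
    intro r
    obtain ⟨c, hc⟩ := hdvd r
    rw [hval' (t * r) (t * c) ?_, map_mul, map_mul, ← hτ]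
    · have := hτmem 1
      rw [zpow_one, mul_one] at this
      simpa using mul_mem_zpowSpan hu this (algebraMap_mem_zpowSpan (φ c))
    · have h2 : t ^ ((v + 1) * q) * (t * r) = t ^ p ^ e * (t ^ (v * q) * r) := by
        rw [hq']; ring
      rw [h2, map_pow_mul, hc]
      ring
  obtain ⟨c₀, hc₀⟩ := hint r₀
  have hc₀' : IsUnit c₀ := by
    rw [hc₀, pow_succ] at hr₀
    have : ¬ t ∣ c₀ := fun h => hr₀ (mul_dvd_mul_left _ h)
    by_contra h3
    rw [← mem_nonunits_iff, ← IsLocalRing.mem_maximalIdeal, htirr.maximalIdeal_eq,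
      Ideal.mem_span_singleton] at h3
    exact this h3
  have hM' : ∃ M' : ℕ, ∀ x ∈ zpowSpan S ϖ M', Ψ' x ∈ zpowSpan S ϖ 1 := by
    -- Write Ψ'(x) = ϖ Ψ(τ^{q - v} ϖ^{-p^e} x). The argument of Ψ lies in ϖ^{M + n q} S, hence in
    -- ϖ^M S.
    refine ⟨M + n * v + p ^ e, fun x hx => ?_⟩
    have h2 : τ ^ ((q : ℤ) - v) * (ϖ ^ (((p ^ e : ℕ) : ℤ) * (-1)) * x) ∈ zpowSpan S ϖ M := by
      refine zpowSpan_antitone hu ?_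
        (mul_mem_zpowSpan hu (hτmem _) (mul_mem_zpowSpan hu zpow_mem_zpowSpan hx))
      have : (0 : ℤ) ≤ n * q := by positivity
      push_cast
      linarith
    have h3 := hM _ h2
    rw [← smul_apply, ← hΨ', map_zpow_mul] at h3
    have h4 := mul_mem_zpowSpan hu (zpow_mem_zpowSpan (S := S) (m := 1)) h3
    rwa [← mul_assoc, ← zpow_add₀ hu, add_neg_cancel, zpow_zero, one_mul, add_zero] at h4
  obtain ⟨M', hM'⟩ := hM'
  have hcore := fun x hx => map_mem_zpowSpan_min Ψ' φ hp hw ht hu hn hcop hres h0 h1 M' hM' 1 x hx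
  have hback : ∀ x, Ψ x = Ψ' (τ ^ (-((q : ℤ) - v)) * x) := by
    intro x
    rw [hΨ', smul_apply, ← mul_assoc, ← zpow_add₀ hτ0, add_neg_cancel, zpow_zero, one_mul]
  constructor
  · intro h
    by_contra! hlt
    -- Sharpness: this element has valuation at least n (q - v) - p^e, which is at least -N once N
    -- exceeds the bound. Its image ϖ^{-1} Ψ'(r₀) is not integral, because Ψ'(r₀) is a unit.
    have h2 : τ ^ ((q : ℤ) - v) * (ϖ ^ (((p ^ e : ℕ) : ℤ) * (-1)) * algebraMap S L (φ r₀)) ∈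
        zpowSpan S ϖ (-N) := by
      refine zpowSpan_antitone hu ?_ (mul_mem_zpowSpan hu (hτmem _)
        (mul_mem_zpowSpan hu zpow_mem_zpowSpan (algebraMap_mem_zpowSpan _)))
      push_cast
      rw [hqz] at hlt ⊢
      linarith
    have h3 := h _ h2
    rw [← smul_apply, ← hΨ', map_zpow_mul, hval' _ _ hc₀] at h3
    obtain ⟨s, hs⟩ := mem_zpowSpan_zero.mp h3
    have h4 : algebraMap S L (φ c₀) = algebraMap S L (u * s) := by
      rw [map_mul, ← hs, ← hϖ, ← mul_assoc, zpow_neg_one, mul_inv_cancel₀ hu, one_mul]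
    have h5 := IsFractionRing.injective S L h4
    exact huirr.not_isUnit (isUnit_of_dvd_unit ⟨s, h5⟩ (hc₀'.map φ))
  · intro h x hx
    rw [hback]
    -- Here Ψ(x) = ϖ^{-1} Ψ'(ϖ^{p^e} τ^{v - q} x), and the bound on N is exactly what puts the
    -- argument in ϖ S.
    have h2 : ϖ ^ (((p ^ e : ℕ) : ℤ) * 1) * (τ ^ (-((q : ℤ) - v)) * x) ∈
        zpowSpan S ϖ ((1 : ℕ) : ℤ) := by
      refine zpowSpan_antitone hu ?_
        (mul_mem_zpowSpan hu zpow_mem_zpowSpan (mul_mem_zpowSpan hu (hτmem _) hx))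
      push_cast
      rw [hqz] at h ⊢
      linarith
    have h3 := hcore _ h2
    rw [map_zpow_mul] at h3
    have h4 := mul_mem_zpowSpan hu (zpow_mem_zpowSpan (S := S) (m := -1)) h3
    rwa [← mul_assoc, ← zpow_add₀ hu, neg_add_cancel, zpow_zero, one_mul, min_self, Nat.cast_one,
      neg_add_cancel] at h4

end PInvLinearMap

/-! ### Tamely ramified extensions of discrete valuation rings -/

theorem exists_map_eq_mul_pow_ramificationIndex {R S : Type u} [CommRing R] [CommRing S]
    [IsDomain R] [IsDiscreteValuationRing R] [IsDomain S] [IsDiscreteValuationRing S]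
    (φ : R →+* S) [IsLocalHom φ] (hφ : Function.Injective φ) {t : R} {u : S}
    (ht : Irreducible t) (hu : Irreducible u) :
    0 < ramificationIndex φ ∧ ∃ w, IsUnit w ∧ φ t = w * u ^ ramificationIndex φ := by
  have h0 : φ t ≠ 0 := (map_ne_zero_iff φ hφ).mpr ht.ne_zero
  obtain ⟨m, w, hm⟩ := IsDiscreteValuationRing.eq_unit_mul_pow_irreducible h0 hu
  -- The set is bounded with maximum m, so its `sSup` is the true valuation of φ t rather than a
  -- default value.
  have hset : {n : ℕ | (IsLocalRing.maximalIdeal R).map φ ≤ IsLocalRing.maximalIdeal S ^ n} =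
      Set.Iic m := by
    ext n
    rw [Set.mem_ofPred_eq, ht.maximalIdeal_eq, hu.maximalIdeal_eq, Ideal.map_span,
      Set.image_singleton, Ideal.span_singleton_pow, Ideal.span_singleton_le_span_singleton, hm,
      Units.dvd_mul_left, pow_dvd_pow_iff hu.ne_zero hu.not_isUnit, Set.mem_Iic]
  have hr : ramificationIndex φ = m := by rw [ramificationIndex, hset, csSup_Iic]
  rw [hr]
  refine ⟨Nat.pos_of_ne_zero ?_, w, w.isUnit, hm⟩
  rintro rfl
  exact ht.not_isUnit (isUnit_of_map_unit φ t (by rw [hm]; simp))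

theorem CharP.residueField (p : ℕ) [Fact p.Prime] (R : Type*) [CommRing R] [IsLocalRing R]
    [CharP R p] : CharP (IsLocalRing.ResidueField R) p := by
  rw [CharP.charP_iff_prime_eq_zero Fact.out, ← map_natCast (IsLocalRing.residue R),
    CharP.cast_eq_zero, map_zero]

namespace IsTamelyRamified

variable {p e : ℕ} [Fact p.Prime] {R S L : Type u} [CommRing R] [CommRing S] [Field L]
  [Algebra S L] [CharP R p] [IsDomain R] [IsDiscreteValuationRing R] [IsDomain S]
  [IsDiscreteValuationRing S] [IsFractionRing S L] {φ : R →+* S} [IsLocalHom φ]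

theorem map_zpowSpan_iff (h : IsTamelyRamified p φ) (Ψ : PInvLinearMap p e L)
    (ψ : PInvLinearMap p e R) (hψ : ψ ≠ 0)
    (hΨ : ∀ r, Ψ (algebraMap S L (φ r)) = algebraMap S L (φ (ψ r)))
    (hbd : ∃ d : S, d ≠ 0 ∧ ∀ s, ∃ s', Ψ (algebraMap S L (d * s)) = algebraMap S L s')
    {u : S} (hu : Irreducible u) (N : ℤ) :
    (∀ x ∈ zpowSpan S (algebraMap S L u) (-N), Ψ x ∈ zpowSpan S (algebraMap S L u) 0) ↔
      N ≤ ramificationIndex φ * ψ.ord.toNat - ((p : ℤ) ^ e - 1) * (ramificationIndex φ - 1) := by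
  have hp : p.Prime := Fact.out
  obtain ⟨t, ht⟩ := IsDiscreteValuationRing.exists_irreducible R
  obtain ⟨hn, w, hw, htw⟩ := exists_map_eq_mul_pow_ramificationIndex φ h.injective ht hu
  obtain ⟨d, hd, hbd⟩ := hbd
  -- The valuation of the denominator d is the starting exponent of the descending induction.
  obtain ⟨M, w', hM⟩ := IsDiscreteValuationRing.eq_unit_mul_pow_irreducible hd hu
  have := CharP.residueField p R
  have := ExpChar.prime (R := IsLocalRing.ResidueField R) hp
  refine PInvLinearMap.map_zpowSpan_iff Ψ ψ φ hΨ hp.ne_zero ht hu hw htw hn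
    (((Nat.coprime_comm.mp ((Nat.Prime.coprime_iff_not_dvd hp).mpr h.not_dvd_ramificationIndex))).pow_right e)
    ?_ M ?_ (ENat.natCast_toNat (PInvLinearMap.ord_ne_top hψ)).symm N
  · intro s
    obtain ⟨x, hx, hs⟩ := IsLocalRing.exists_mem_closure_mul_pow_sub_mem φ p e
      h.residueField_separable s
    rw [hu.maximalIdeal_eq, Ideal.mem_span_singleton] at hs
    obtain ⟨s', hs'⟩ := hs
    exact ⟨x, hx, s', by rw [← hs']; ring⟩
  · intro x hx
    obtain ⟨s, rfl⟩ := mem_zpowSpan.mp hx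
    obtain ⟨s', hs'⟩ := hbd ((w'⁻¹ : Sˣ) * s)
    refine mem_zpowSpan_zero.mpr ⟨s', ?_⟩
    rw [← hs', hM, zpow_natCast, ← map_pow, ← map_mul]
    congr 2
    rw [mul_mul_mul_comm, Units.mul_inv, one_mul]

/-- Dividing by u^k turns k ≤ ord into the condition that Ψ maps u^{-k} S into S, so the order is
read off from `map_zpowSpan_iff` by varying k. -/
theorem ord_eq (h : IsTamelyRamified p φ) (L : Type u) [Field L] [Algebra S L] [IsFractionRing S L]
    (Ψ : PInvLinearMap p e L) (ψ : PInvLinearMap p e R) (hψ : ψ ≠ 0) (ψS : PInvLinearMap p e S)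
    (hΨ : ∀ s, Ψ (algebraMap S L s) = algebraMap S L (ψS s)) (hψS : ∀ r, ψS (φ r) = φ (ψ r)) :
    (ψS.ord.toNat : ℤ) = ramificationIndex φ * ψ.ord.toNat -
      ((p : ℤ) ^ e - 1) * (ramificationIndex φ - 1) := by
  have hp : p.Prime := Fact.out
  obtain ⟨u, hu⟩ := IsDiscreteValuationRing.exists_irreducible S
  have hu0 : algebraMap S L u ≠ 0 := by simpa using hu.ne_zero
  have key := h.map_zpowSpan_iff Ψ ψ hψ (fun r => by rw [hΨ, hψS])
    ⟨1, one_ne_zero, fun s => ⟨ψS s, by rw [one_mul, hΨ]⟩⟩ hu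
  set V := (ramificationIndex φ * ψ.ord.toNat -
      ((p : ℤ) ^ e - 1) * (ramificationIndex φ - 1) : ℤ) with hV
  have hord : ∀ k : ℕ, (k : ℕ∞) ≤ ψS.ord ↔ (k : ℤ) ≤ V := by
    intro k
    rw [← key, PInvLinearMap.natCast_le_ord_iff hp.ne_zero hu]
    have hq : 0 < p ^ e := pow_pos hp.pos e
    have hpow : ∀ s, Ψ (algebraMap S L u ^ (-(k : ℤ)) * algebraMap S L s) =
        algebraMap S L u ^ (-(k : ℤ)) * algebraMap S L (ψS (u ^ (k * (p ^ e - 1)) * s)) := by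
      intro s
      rw [← hΨ, ← PInvLinearMap.map_zpow_mul, map_mul (algebraMap S L), ← mul_assoc, map_pow,
        ← zpow_natCast (algebraMap S L u) (k * (p ^ e - 1)), ← zpow_add₀ hu0]
      congr 3
      obtain ⟨q, hq'⟩ : ∃ q, p ^ e = q + 1 := ⟨p ^ e - 1, by omega⟩
      rw [hq']
      simp only [Nat.add_sub_cancel]
      push_cast
      ring
    constructor
    · intro h1 x hx
      obtain ⟨s, rfl⟩ := mem_zpowSpan.mp hx
      obtain ⟨c, hc⟩ := h1 s
      refine mem_zpowSpan_zero.mpr ⟨c, ?_⟩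
      rw [hpow, hc, map_mul, map_pow, zpow_neg, zpow_natCast, inv_mul_cancel_left₀]
      exact pow_ne_zero _ hu0
    · intro h1 s
      obtain ⟨c, hc⟩ := mem_zpowSpan_zero.mp (h1 _ (mem_zpowSpan.mpr ⟨s, rfl⟩))
      refine ⟨c, IsFractionRing.injective S L ?_⟩
      rw [map_mul (algebraMap S L), ← hc, hpow, map_pow, zpow_neg, zpow_natCast, mul_inv_cancel_left₀]
      exact pow_ne_zero _ hu0
  -- The case k = 0 holds trivially, which forces V to be a natural number.
  have hV0 : 0 ≤ V := by simpa using (hord 0).mp (by simp)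
  obtain ⟨v, hv⟩ := Int.eq_ofNat_of_zero_le hV0
  rw [hv] at hord ⊢
  have : ψS.ord = v := le_antisymm
    (ENat.forall_natCast_le_iff_le.mp fun k hk => by exact_mod_cast (hord k).mp hk)
    ((hord v).mpr le_rfl)
  rw [this, ENat.toNat_natCast]

theorem exists_map_algebraMap_eq (h : IsTamelyRamified p φ) (Ψ : PInvLinearMap p e L)
    (ψ : PInvLinearMap p e R) (hψ : ψ ≠ 0)
    (hΨ : ∀ r, Ψ (algebraMap S L (φ r)) = algebraMap S L (φ (ψ r)))
    (hbd : ∃ d : S, d ≠ 0 ∧ ∀ s, ∃ s', Ψ (algebraMap S L (d * s)) = algebraMap S L s')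
    (hle : ((p : ℤ) ^ e - 1) * (ramificationIndex φ - 1) ≤ ramificationIndex φ * ψ.ord.toNat)
    (s : S) : ∃ s', Ψ (algebraMap S L s) = algebraMap S L s' := by
  obtain ⟨u, hu⟩ := IsDiscreteValuationRing.exists_irreducible S
  refine mem_zpowSpan_zero.mp ((h.map_zpowSpan_iff Ψ ψ hψ hΨ hbd hu 0).mpr (by linarith) _ ?_)
  rw [neg_zero]
  exact algebraMap_mem_zpowSpan s

end IsTamelyRamified

/-! ### Extending `p^{-e}`-linear maps along separable extensions -/

namespace PInvLinearMap

variable {p e : ℕ}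

/-- By separability the p^e-th powers of a basis b_i of L over K again form a basis. So c b_i^{p^e}
↦ ψ(c) b_i defines an additive map, which satisfies F(k z^{p^e}) = ψ(k) z for all k and z. -/
theorem exists_extension_of_isSeparable [Fact p.Prime] {K L : Type u} [Field K] [Field L]
    [Algebra K L] [Algebra.IsSeparable K L] [CharP K p] (ψ : PInvLinearMap p e K) :
    ∃ Ψ : PInvLinearMap p e L, ∀ k, Ψ (algebraMap K L k) = algebraMap K L (ψ k) := by
  have hp : p.Prime := Fact.out
  have : ExpChar K p := ExpChar.prime hp
  have : CharP L p := charP_of_injective_algebraMap (algebraMap K L).injective p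
  let b := Module.Basis.ofVectorSpace K L
  let b' := b.mapPowExpCharPowOfIsSeparable p e
  have hb' : ∀ i, b' i = b i ^ p ^ e := fun i => by
    simp [b', Module.Basis.mapPowExpCharPowOfIsSeparable]
  let f : (Module.Basis.ofVectorSpaceIndex K L →₀ K) →+ L :=
    Finsupp.liftAddHom fun i =>
      (AddMonoidHom.mulRight (b i)).comp ((algebraMap K L).toAddMonoidHom.comp ψ.toAddMonoidHom)
  let F : L →+ L := f.comp b'.repr.toAddEquiv.toAddMonoidHom
  have hFb : ∀ (k : K) i, F (algebraMap K L k * b i ^ p ^ e) = algebraMap K L (ψ k) * b i := by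
    intro k i
    rw [← hb', ← Algebra.smul_def]
    change f (b'.repr (k • b' i)) = _
    rw [map_smul, Module.Basis.repr_self, Finsupp.smul_single, smul_eq_mul, mul_one]
    change Finsupp.liftAddHom _ (Finsupp.single i k) = _
    rw [Finsupp.liftAddHom_apply_single]
    rfl
  have hF : ∀ (k : K) (z : L), F (algebraMap K L k * z ^ p ^ e) = algebraMap K L (ψ k) * z := by
    intro k z
    induction b.mem_span z using Submodule.closure_induction with
    | zero => simp [hp.ne_zero]
    | add x y _ _ hx hy => rw [add_pow_char_pow, mul_add, map_add, hx, hy, mul_add]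
    | smul_mem c x hx =>
      obtain ⟨i, rfl⟩ := hx
      rw [Algebra.smul_def, mul_pow, ← map_pow, ← mul_assoc, ← map_mul, mul_comm k, hFb,
        map_pow_mul, map_mul]
      ring
  refine ⟨{ F with map_pow_mul' := ?_ }, fun k => ?_⟩
  · intro r a
    change F _ = r * F a
    induction b'.mem_span a using Submodule.closure_induction with
    | zero => simp
    | add x y _ _ hx hy => rw [mul_add, map_add, map_add, hx, hy, mul_add]
    | smul_mem c x hx =>
      obtain ⟨i, rfl⟩ := hx
      rw [hb', Algebra.smul_def, mul_left_comm, ← mul_pow, hF, hF]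
      ring
  · change F _ = _
    have := hF k 1
    rwa [one_pow, mul_one, mul_one] at this

end PInvLinearMap

/-! ### Normal domains are intersections of their localizations at primes of height one -/

/-- If f were not in B, a maximal conductor of a multiple x = f c outside B would be a prime P. Were
xP ⊆ P, then x would be integral, hence in B. Otherwise P is minimal over a principal ideal and has
height one, contradicting the hypothesis on f at P. -/
theorem IsIntegrallyClosed.exists_algebraMap_eq_of_height_one {B L : Type*} [CommRing B]
    [IsDomain B] [IsNoetherianRing B] [IsIntegrallyClosed B] [Field L] [Algebra B L]
    [IsFractionRing B L] (f : L)
    (hf : ∀ P : Ideal B, P.IsPrime → P.height = 1 →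
      ∃ b c : B, c ∉ P ∧ f * algebraMap B L c = algebraMap B L b) :
    ∃ b, f = algebraMap B L b := by
  by_contra hfB
  let conductor (x : L) : Ideal B :=
    { carrier := {c | ∃ b, x * algebraMap B L c = algebraMap B L b}
      zero_mem' := ⟨0, by simp⟩
      add_mem' := by
        rintro c d ⟨b, hb⟩ ⟨b', hb'⟩
        exact ⟨b + b', by rw [map_add, mul_add, hb, hb', map_add]⟩
      smul_mem' := by
        rintro c d ⟨b, hb⟩
        exact ⟨c * b, by rw [smul_eq_mul, map_mul, map_mul, ← hb]; ring⟩ }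
  have hmem : ∀ x c, c ∈ conductor x ↔ ∃ b, x * algebraMap B L c = algebraMap B L b :=
    fun x c => Iff.rfl
  let T : Set (Ideal B) := {I | ∃ c : B, f * algebraMap B L c ∉ (algebraMap B L).range ∧
    I = conductor (f * algebraMap B L c)}
  have hT : T.Nonempty := ⟨_, 1, by simpa [eq_comm] using hfB, rfl⟩
  obtain ⟨P, ⟨c, hcB, rfl⟩, hmax⟩ := set_has_maximal_iff_noetherian.mpr ‹IsNoetherianRing B› T hT
  set x := f * algebraMap B L c with hx
  have hprime : (conductor x).IsPrime := by
    refine ⟨?_, ?_⟩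
    · rw [Ideal.ne_top_iff_one, hmem]
      rintro ⟨b, hb⟩
      exact hcB ⟨b, by rw [← hb, map_one, mul_one]⟩
    · intro a b hab
      by_contra! hcon
      obtain ⟨ha, hb⟩ := hcon
      have hb' : f * algebraMap B L (c * b) ∉ (algebraMap B L).range := by
        rintro ⟨b', hb'⟩
        exact hb ⟨b', by rw [hb', map_mul, hx]; ring⟩
      have hle : conductor x ≤ conductor (f * algebraMap B L (c * b)) := by
        rintro d ⟨b', hb'⟩
        exact ⟨b' * b, by rw [map_mul, map_mul, ← hb', hx]; ring⟩
      have heq := hmax _ ⟨_, hb', rfl⟩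
      refine heq (lt_of_le_of_ne hle fun h => ha ?_)
      rw [h]
      obtain ⟨b', hb'⟩ := hab
      exact ⟨b', by rw [← hb', map_mul, map_mul, hx]; ring⟩
  have hne : conductor x ≠ ⊥ := by
    obtain ⟨a, b, hb, hab⟩ := IsFractionRing.div_surjective (A := B) x
    intro h
    have hb0 : b ≠ 0 := nonZeroDivisors.ne_zero hb
    have : b ∈ conductor x := ⟨a, by
      rw [← hab, div_mul_cancel₀]
      simpa using hb0⟩
    rw [h] at this
    exact hb0 this
  obtain ⟨y, hy, s, hs, hxy⟩ : ∃ y ∈ conductor x, ∃ s ∉ conductor x,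
      x * algebraMap B L y = algebraMap B L s := by
    by_contra! hcon
    have hint : IsIntegral B x := by
      refine isIntegral_of_smul_mem_submodule (M := L)
        (Submodule.map (Algebra.linearMap B L) (conductor x)) ?_ ?_ x ?_
      · obtain ⟨y, hy, hy0⟩ := Submodule.exists_mem_ne_zero_of_ne_bot hne
        intro h
        have := h ▸ Submodule.mem_map_of_mem (f := Algebra.linearMap B L) hy
        simp [hy0] at this
      · exact (IsNoetherian.noetherian _).map _
      · rintro _ ⟨y, hy, rfl⟩
        obtain ⟨s, hs⟩ := hy
        by_contra hcon2
        refine hcon y ⟨s, hs⟩ s (fun h => hcon2 ⟨s, h, ?_⟩) hs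
        rw [smul_eq_mul, Algebra.linearMap_apply, Algebra.linearMap_apply, hs]
    obtain ⟨b, hb⟩ := IsIntegrallyClosed.algebraMap_eq_of_integral hint
    exact hcB ⟨b, hb⟩
  -- For z in P one has s z = (x z) y with x z in B. So a prime Q ⊆ P containing y contains s z, and
  -- therefore z, since s is not in P.
  have hmin : conductor x ∈ (Ideal.span {y}).minimalPrimes := by
    refine ⟨⟨hprime, (Ideal.span_singleton_le_iff_mem _).mpr hy⟩, ?_⟩
    rintro Q ⟨hQ, hyQ⟩ hle z ⟨b, hb⟩
    have h1 : s * z = b * y := by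
      apply IsFractionRing.injective B L
      rw [map_mul, map_mul, ← hxy, ← hb]
      ring
    have h2 : s * z ∈ Q := h1 ▸ Q.mul_mem_left _ ((Ideal.span_singleton_le_iff_mem _).mp hyQ)
    exact (hQ.mem_or_mem h2).resolve_left fun h => hs (hle h)
  have hht : (conductor x).height = 1 := by
    apply le_antisymm
    · exact Ideal.height_le_one_of_isPrincipal_of_mem_minimalPrimes (Ideal.span {y}) _ hmin
    · rwa [Order.one_le_iff_ne_zero, Ne, Ideal.height_eq_zero_iff_eq_bot]
  obtain ⟨b, d, hd, hbd⟩ := hf _ hprime hht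
  exact hd ⟨b * c, by rw [map_mul, ← hbd, hx]; ring⟩

/-! ### Denominators of extensions -/

section Denominators

variable {p e : ℕ} {A B K L : Type u} [CommRing A] [IsDomain A] [CommRing B] [IsDomain B] [Field K] [Field L]
  [Algebra A B] [Algebra A K] [Algebra A L] [Algebra B L] [Algebra K L] [IsScalarTower A B L]
  [IsScalarTower A K L] [IsFractionRing A K] [IsFractionRing B L]

theorem pow_mul_mem_span_pow {A B L : Type*} [CommRing A] [CommRing B] [CommRing L]
    [Algebra A L] [Algebra B L] {q : ℕ} (d : B) {x : L}
    (hx : x ∈ Submodule.span A {y : L | ∃ z : B, y = algebraMap B L z ^ q}) :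
    algebraMap B L d ^ q * x ∈ Submodule.span A {y : L | ∃ z : B, y = algebraMap B L z ^ q} := by
  induction hx using Submodule.span_induction with
  | zero => simp
  | add x y _ _ hx hy => rw [mul_add]; exact add_mem hx hy
  | smul a x _ hx => rw [mul_smul_comm]; exact Submodule.smul_mem _ _ hx
  | mem x hx =>
    obtain ⟨z, rfl⟩ := hx
    exact Submodule.subset_span ⟨d * z, by rw [map_mul, mul_pow]⟩

/-- L is additively generated by products c z^{p^e}. A denominator b of c and a denominator w of z
are cleared together by (b w)^{p^e}. -/
theorem exists_pow_mul_mem_span [Algebra.IsSeparable K L] [ExpChar K p] (hp : p ≠ 0) (x : L) :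
    ∃ d : B, d ≠ 0 ∧ algebraMap B L d ^ p ^ e * x ∈
      Submodule.span A {y : L | ∃ z : B, y = algebraMap B L z ^ p ^ e} := by
  induction IsSeparable.mem_closure_mul_pow (K := K) p e x using AddSubgroup.closure_induction with
  | zero => exact ⟨1, one_ne_zero, by simp⟩
  | add x y _ _ hx hy =>
    obtain ⟨d, hd, hx⟩ := hx
    obtain ⟨d', hd', hy⟩ := hy
    refine ⟨d * d', mul_ne_zero hd hd', ?_⟩
    rw [map_mul, mul_pow, mul_add]
    refine add_mem ?_ ?_
    · rw [mul_comm (_ ^ _), mul_assoc]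
      exact pow_mul_mem_span_pow _ hx
    · rw [mul_assoc]
      exact pow_mul_mem_span_pow _ hy
  | neg x _ hx =>
    obtain ⟨d, hd, hx⟩ := hx
    exact ⟨d, hd, by rw [mul_neg]; exact neg_mem hx⟩
  | mem x hx =>
    obtain ⟨c, z, rfl⟩ := hx
    obtain ⟨a, b, hb, rfl⟩ := IsFractionRing.div_surjective (A := A) c
    obtain ⟨z, w, hw, rfl⟩ := IsFractionRing.div_surjective (A := B) z
    have hbK : algebraMap A K b ≠ 0 :=
      IsFractionRing.to_map_ne_zero_of_mem_nonZeroDivisors hb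
    have hbL : algebraMap A L b ≠ 0 := by
      rw [IsScalarTower.algebraMap_apply A K L]
      simpa using hbK
    have hbB : algebraMap A B b ≠ 0 := by
      intro h
      rw [IsScalarTower.algebraMap_apply A B L, h, map_zero] at hbL
      exact hbL rfl
    have hw0 : w ≠ 0 := nonZeroDivisors.ne_zero hw
    have hwL : algebraMap B L w ≠ 0 := by simpa using hw0
    refine ⟨algebraMap A B b * w, mul_ne_zero hbB hw0, ?_⟩
    obtain ⟨q, hq⟩ : ∃ q, p ^ e = q + 1 :=
      ⟨p ^ e - 1, (Nat.succ_pred_eq_of_pos (pow_pos (Nat.pos_of_ne_zero hp) e)).symm⟩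
    have h1 : algebraMap B L (algebraMap A B b * w) ^ p ^ e *
        (algebraMap K L (algebraMap A K a / algebraMap A K b) *
          (algebraMap B L z / algebraMap B L w) ^ p ^ e) =
        (b ^ q * a) • algebraMap B L z ^ p ^ e := by
      rw [Algebra.smul_def, map_div₀, ← IsScalarTower.algebraMap_apply A K L,
        ← IsScalarTower.algebraMap_apply A K L, map_mul, ← IsScalarTower.algebraMap_apply A B L,
        map_mul, map_pow, div_pow, hq]
      field_simp
      ring
    rw [h1]
    exact Submodule.smul_mem _ _ (Submodule.subset_span ⟨z, rfl⟩)

/-- Ψ sends the A-span of the p^e-th powers of B into B, since Ψ(a z^{p^e}) = z Ψ(a). Finitely many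
generators of B over A have a common D with D^{p^e} B inside this span. -/
theorem PInvLinearMap.exists_denominator [Module.Finite A B] [Algebra.IsSeparable K L]
    [ExpChar K p] (hp : p ≠ 0) (Ψ : PInvLinearMap p e L)
    (hΨ : ∀ a, ∃ a', Ψ (algebraMap A L a) = algebraMap A L a') :
    ∃ d : B, d ≠ 0 ∧ ∀ b, ∃ b', Ψ (algebraMap B L (d * b)) = algebraMap B L b' := by
  obtain ⟨s, hs⟩ := Module.Finite.fg_top (R := A) (M := B)
  choose d hd hds using fun x : L => exists_pow_mul_mem_span (A := A) (B := B) (K := K)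
    (p := p) (e := e) hp x
  let D : B := ∏ g ∈ s, d (algebraMap B L g)
  have hval : ∀ x ∈ Submodule.span A {y : L | ∃ z : B, y = algebraMap B L z ^ p ^ e},
      ∀ a : A, ∃ b', Ψ (a • x) = algebraMap B L b' := by
    intro x hx
    induction hx using Submodule.span_induction with
    | zero => exact fun a => ⟨0, by simp⟩
    | add x y _ _ hx hy =>
      intro a
      obtain ⟨b, hb⟩ := hx a
      obtain ⟨b', hb'⟩ := hy a
      exact ⟨b + b', by rw [smul_add, map_add, hb, hb', map_add]⟩
    | smul c x _ hx =>
      intro a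
      rw [smul_smul]
      exact hx _
    | mem x hx =>
      intro a
      obtain ⟨z, rfl⟩ := hx
      obtain ⟨a', ha'⟩ := hΨ a
      refine ⟨z * algebraMap A B a', ?_⟩
      rw [Algebra.smul_def, mul_comm, map_pow_mul, ha', map_mul,
        ← IsScalarTower.algebraMap_apply A B L]
  have hD : ∀ b : B, algebraMap B L D ^ p ^ e * algebraMap B L b ∈
      Submodule.span A {y : L | ∃ z : B, y = algebraMap B L z ^ p ^ e} := by
    intro b
    have hb : b ∈ Submodule.span A (s : Set B) := hs ▸ trivial
    induction hb using Submodule.span_induction with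
    | zero => simp
    | add x y _ _ hx hy => rw [map_add, mul_add]; exact add_mem hx hy
    | smul a x _ hx =>
      rw [Algebra.smul_def, map_mul, ← IsScalarTower.algebraMap_apply A B L, mul_left_comm,
        ← Algebra.smul_def]
      exact Submodule.smul_mem _ _ hx
    | mem x hx =>
      obtain ⟨c, hc⟩ := Finset.dvd_prod_of_mem (fun g => d (algebraMap B L g)) hx
      have hc' : D = c * d (algebraMap B L x) := by rw [mul_comm]; exact hc
      rw [hc', map_mul, mul_pow, mul_assoc]
      exact pow_mul_mem_span_pow c (hds _)
  refine ⟨D ^ p ^ e, pow_ne_zero _ (Finset.prod_ne_zero_iff.mpr fun g _ => hd _), fun b => ?_⟩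
  obtain ⟨b', hb'⟩ := hval _ (hD b) 1
  exact ⟨b', by rw [← hb', one_smul, map_mul, map_pow]⟩

end Denominators

/-! ### Stalks, codimension and rational functions on normal schemes. -/

namespace AlgebraicGeometry.Scheme

variable {X Y : Scheme.{u}}

theorem charP_stalk {k : Type u} [Field k] (p : ℕ) [CharP k p] (s : X ⟶ Spec (.of k)) (x : X)
    [Nontrivial (X.presheaf.stalk x)] : CharP (X.presheaf.stalk x) p :=
  charP_of_injective_ringHom
    (f := ((Scheme.ΓSpecIso (.of k)).inv ≫ s.appTop ≫ X.presheaf.germ ⊤ x trivial).hom)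
    (RingHom.injective (R := k) _) p

theorem isIntegrallyClosed_of_isAffineOpen [IsIntegral X] {U : X.Opens} [Nonempty U]
    (hU : IsAffineOpen U) (hX : ∀ x : X, IsIntegrallyClosed (X.presheaf.stalk x)) :
    IsIntegrallyClosed Γ(X, U) := by
  refine IsIntegrallyClosed.of_localization_maximal fun P _ hP => ?_
  let y : PrimeSpectrum Γ(X, U) := ⟨P, hP.isPrime⟩
  have hy : hU.fromSpec y ∈ U := by
    have : hU.fromSpec y ∈ Set.range hU.fromSpec := ⟨y, rfl⟩
    rwa [hU.range_fromSpec] at this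
  let := TopCat.Presheaf.algebra_section_stalk X.presheaf ⟨hU.fromSpec y, hy⟩
  have : IsLocalization.AtPrime (X.presheaf.stalk (hU.fromSpec y)) P :=
    hU.isLocalization_stalk' y hy
  have := hX (hU.fromSpec y)
  exact IsIntegrallyClosed.of_equiv
    (IsLocalization.algEquiv P.primeCompl (X.presheaf.stalk (hU.fromSpec y))
      (Localization.AtPrime P)).toRingEquiv

theorem isDiscreteValuationRing_stalk [IsIntegral X] [IsLocallyNoetherian X] (x : X)
    [IsIntegrallyClosed (X.presheaf.stalk x)] (hx : Order.coheight x = 1) :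
    IsDiscreteValuationRing (X.presheaf.stalk x) := by
  have hdim : ringKrullDim (X.presheaf.stalk x) = 1 := by
    rw [ringKrullDim_stalk_eq_coheight, hx]; rfl
  have : Ring.KrullDimLE 1 (X.presheaf.stalk x) := krullDimLE_of_coheight_le hx.le
  have hf : ¬ IsField (X.presheaf.stalk x) := by
    intro h
    rw [ringKrullDim_eq_zero_of_isField h] at hdim
    exact zero_ne_one hdim
  have hm : IsLocalRing.maximalIdeal (X.presheaf.stalk x) ≠ ⊥ :=
    fun h => hf (IsLocalRing.isField_iff_maximalIdeal_eq.mpr h)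
  have huniq : ∃! P : Ideal (X.presheaf.stalk x), P ≠ ⊥ ∧ P.IsPrime := by
    refine ⟨IsLocalRing.maximalIdeal _, ⟨hm, inferInstance⟩, fun P hP => ?_⟩
    have := hP.2
    exact IsLocalRing.eq_maximalIdeal (Ideal.isMaximal_of_isPrime_of_ne_bot P hP.1)
  have h : IsDiscreteValuationRing (X.presheaf.stalk x) ↔ IsIntegrallyClosed (X.presheaf.stalk x) ∧
      ∃! P : Ideal (X.presheaf.stalk x), P ≠ ⊥ ∧ P.IsPrime :=
    (IsDiscreteValuationRing.TFAE (X.presheaf.stalk x) hf).out 0 3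
  exact h.mpr ⟨‹_›, huniq⟩

theorem height_primeIdealOf {U : X.Opens} (hU : IsAffineOpen U) (x : U) :
    (hU.primeIdealOf x).asIdeal.height = Order.coheight x.1 := by
  let := TopCat.Presheaf.algebra_section_stalk X.presheaf x
  have := hU.isLocalization_stalk x
  have h := IsLocalization.AtPrime.ringKrullDim_eq_height (hU.primeIdealOf x).asIdeal
    (X.presheaf.stalk x.1)
  rw [ringKrullDim_stalk_eq_coheight] at h
  exact_mod_cast h.symm

end AlgebraicGeometry.Scheme

theorem IsField.injective {K S : Type*} [CommRing K] [CommRing S] [Nontrivial S] (hK : IsField K)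
    (f : K →+* S) : Function.Injective f := by
  let := hK.toField
  exact RingHom.injective f

/-- Going down holds over a normal domain, so the height of P is that of its contraction plus the
height of P in the fibre. The latter vanishes by incomparability. -/
theorem Ideal.height_under_of_isIntegral {A B : Type*} [CommRing A] [CommRing B] [IsDomain B]
    [IsNoetherianRing A] [IsNoetherianRing B] [Algebra A B] [Algebra.IsIntegral A B]
    [FaithfulSMul A B] [IsIntegrallyClosed A] (P : Ideal B) [P.IsPrime] :
    (P.under A).height = P.height := by
  rw [Ideal.height_eq_height_add_of_liesOver_of_hasGoingDown (P.under A) P]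
  set I := (P.under A).map (algebraMap A B) with hI
  have h : I ≤ P := Ideal.map_comap_le
  have hP : (P.map (Ideal.Quotient.mk I)).IsPrime :=
    Ideal.map_isPrime_of_surjective Ideal.Quotient.mk_surjective (by rwa [Ideal.mk_ker])
  have hcomap : (P.map (Ideal.Quotient.mk I)).comap (Ideal.Quotient.mk I) = P := by
    rw [Ideal.comap_map_of_surjective _ Ideal.Quotient.mk_surjective, ← RingHom.ker_eq_comap_bot,
      Ideal.mk_ker, sup_eq_left]
    exact h
  have : (P.map (Ideal.Quotient.mk I)).height = 0 := by
    rw [Ideal.height_eq_zero_iff]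
    refine ⟨⟨hP, bot_le⟩, ?_⟩
    rintro Q ⟨hQ, -⟩ hQP
    change P.map (Ideal.Quotient.mk I) ≤ Q
    rw [Ideal.map_le_iff_le_comap]
    by_contra hle
    have hQP' : Q.comap (Ideal.Quotient.mk I) ≤ P :=
      (Ideal.comap_mono hQP).trans_eq hcomap
    have hprime := hQ.comap (Ideal.Quotient.mk I)
    refine (Ideal.IsIntegral.comap_lt_comap (R := A) (lt_of_le_not_ge hQP' hle)).not_ge ?_
    change P.under A ≤ _
    rw [← Ideal.map_le_iff_le_comap, ← hI]
    intro z hz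
    rw [Ideal.mem_comap, Ideal.Quotient.eq_zero_iff_mem.mpr hz]
    exact zero_mem _
  rw [this, add_zero]

namespace AlgebraicGeometry.Scheme

variable {X Y : Scheme.{u}}

theorem genericPoint_map_of_surjective [IrreducibleSpace X] [IrreducibleSpace Y] (π : Y ⟶ X)
    [Surjective π] : π (genericPoint Y) = genericPoint X := by
  apply ((genericPoint_spec X).eq _).symm
  have h := (genericPoint_spec Y).image π.continuous
  rwa [Set.image_univ, π.surjective.range_eq, closure_univ] at h

theorem isField_stalk_map_genericPoint [IsIntegral X] [IrreducibleSpace Y] (π : Y ⟶ X)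
    [Surjective π] : IsField (X.presheaf.stalk (π (genericPoint Y))) := by
  rw [genericPoint_map_of_surjective]
  exact Field.toIsField X.functionField

theorem app_injective_of_surjective [IsIntegral X] [IsIntegral Y] (π : Y ⟶ X) [Surjective π]
    (U : X.Opens) [Nonempty (π ⁻¹ᵁ U)] : Function.Injective (π.app U).hom := by
  have hη : genericPoint Y ∈ π ⁻¹ᵁ U :=
    ((genericPoint_spec Y).mem_open_set_iff (π ⁻¹ᵁ U).isOpen).mpr
      (by simpa using Set.nonempty_coe_sort.mp ‹Nonempty (π ⁻¹ᵁ U)›)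
  have h : Function.Injective ((π.stalkMap (genericPoint Y)).hom.comp
      (X.presheaf.germ U (π (genericPoint Y)) hη).hom) :=
    ((isField_stalk_map_genericPoint π).injective
      (π.stalkMap (genericPoint Y)).hom).comp (germ_injective_of_isIntegral X _ hη)
  intro a b hab
  apply h
  have hg : ∀ c, (π.stalkMap (genericPoint Y)).hom.comp
      (X.presheaf.germ U (π (genericPoint Y)) hη).hom c =
        (Y.presheaf.germ (π ⁻¹ᵁ U) (genericPoint Y) hη).hom ((π.app U).hom c) :=
    fun c => Scheme.Hom.germ_stalkMap_apply π U _ hη c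
  rw [hg, hg, hab]

theorem coheight_map_of_isFinite [IsIntegral X] [IsIntegral Y] [IsLocallyNoetherian X]
    [IsLocallyNoetherian Y]
    (hX : ∀ x : X, IsIntegrallyClosed (X.presheaf.stalk x)) (π : Y ⟶ X) [IsFinite π]
    [Surjective π] (y : Y) : Order.coheight (π y) = Order.coheight y := by
  obtain ⟨_, ⟨U, hU, rfl⟩, hyU, -⟩ :=
    X.isBasis_affineOpens.exists_subset_of_mem_open (Set.mem_univ (π y)) isOpen_univ
  have hV : IsAffineOpen (π ⁻¹ᵁ U) := hU.preimage π
  have : Nonempty U := ⟨⟨_, hyU⟩⟩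
  have : Nonempty (π ⁻¹ᵁ U) := ⟨⟨y, hyU⟩⟩
  let := (π.app U).hom.toAlgebra
  have : Module.Finite Γ(X, U) Γ(Y, π ⁻¹ᵁ U) := π.finite_app U hU
  have := isIntegrallyClosed_of_isAffineOpen hU hX
  have : IsNoetherianRing Γ(Y, π ⁻¹ᵁ U) := IsLocallyNoetherian.component_noetherian ⟨_, hV⟩
  have : FaithfulSMul Γ(X, U) Γ(Y, π ⁻¹ᵁ U) := by
    rw [faithfulSMul_iff_algebraMap_injective]
    exact app_injective_of_surjective π U
  have : IsNoetherianRing Γ(X, U) := IsLocallyNoetherian.component_noetherian ⟨_, hU⟩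
  have h := IsAffineOpen.comap_primeIdealOf_appLE U hU (π ⁻¹ᵁ U) hV le_rfl hyU
  have h1 := height_primeIdealOf hU ⟨π y, hyU⟩
  rw [← h, ← Scheme.Hom.app_eq_appLE] at h1
  rw [← height_primeIdealOf hV ⟨y, hyU⟩, ← h1]
  exact Ideal.height_under_of_isIntegral (A := Γ(X, U)) _

/-- Height one primes of Γ(X, W) are the codimension one points of W, so the algebraic statement
about intersections of localizations applies. -/
theorem exists_germToFunctionField_eq_of_isAffineOpen [IsIntegral X] [IsLocallyNoetherian X]
    (hX : ∀ x : X, IsIntegrallyClosed (X.presheaf.stalk x)) {W : X.Opens} [Nonempty W]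
    (hW : IsAffineOpen W) (f : X.functionField)
    (hf : ∀ x ∈ W, Order.coheight x = 1 → ∃ s, f = algebraMap (X.presheaf.stalk x) X.functionField s) :
    ∃ a, f = X.germToFunctionField W a := by
  have := isIntegrallyClosed_of_isAffineOpen hW hX
  have := functionField_isFractionRing_of_isAffineOpen X W hW
  have : IsNoetherianRing Γ(X, W) := IsLocallyNoetherian.component_noetherian ⟨_, hW⟩
  refine IsIntegrallyClosed.exists_algebraMap_eq_of_height_one f fun P hP hht => ?_
  let y : PrimeSpectrum Γ(X, W) := ⟨P, hP⟩
  have hy : hW.fromSpec y ∈ W := by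
    have : hW.fromSpec y ∈ Set.range hW.fromSpec := ⟨y, rfl⟩
    rwa [hW.range_fromSpec] at this
  let := TopCat.Presheaf.algebra_section_stalk X.presheaf ⟨hW.fromSpec y, hy⟩
  have hloc : IsLocalization.AtPrime (X.presheaf.stalk (hW.fromSpec y)) P :=
    hW.isLocalization_stalk' y hy
  have hco : Order.coheight (hW.fromSpec y) = 1 := by
    have h := IsLocalization.AtPrime.ringKrullDim_eq_height P
      (X.presheaf.stalk (hW.fromSpec y))
    rw [ringKrullDim_stalk_eq_coheight, hht] at h
    exact_mod_cast h
  obtain ⟨s, rfl⟩ := hf _ hy hco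
  obtain ⟨⟨b, c⟩, hbc⟩ := IsLocalization.surj P.primeCompl s
  refine ⟨b, c, c.2, ?_⟩
  have := congrArg (algebraMap (X.presheaf.stalk (hW.fromSpec y)) X.functionField) hbc
  rw [map_mul] at this
  have h2 : ∀ a, algebraMap (X.presheaf.stalk (hW.fromSpec y)) X.functionField
      (algebraMap Γ(X, W) (X.presheaf.stalk (hW.fromSpec y)) a) =
        algebraMap Γ(X, W) X.functionField a :=
    fun a => algebraMap_germ_eq_germToFunctionField X hy a
  rwa [h2, h2] at this

theorem germToFunctionField_res [IrreducibleSpace X] {U V : X.Opens} [Nonempty U] [Nonempty V]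
    (h : V ≤ U) (a : Γ(X, U)) :
    X.germToFunctionField V ((X.presheaf.map (homOfLE h).op).hom a) =
      X.germToFunctionField U a :=
  TopCat.Presheaf.germ_res_apply _ _ _ _ _

theorem exists_germToFunctionField_eq [IsIntegral X] (f : X.functionField) (V : X.Opens)
    [Nonempty V]
    (hf : ∀ (W : X.Opens) [Nonempty W], IsAffineOpen W → W ≤ V →
      ∃ a, f = X.germToFunctionField W a) :
    ∃ a, f = X.germToFunctionField V a := by
  let I : Type u := {W : X.Opens // Nonempty W ∧ IsAffineOpen W ∧ W ≤ V}
  have hI : ∀ i : I, Nonempty i.1 := fun i => i.2.1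
  choose sf hsf using fun i : I => hf i.1 i.2.2.1 i.2.2.2
  have hcover : V ≤ ⨆ i : I, i.1 := by
    intro x hx
    obtain ⟨_, ⟨W, hW, rfl⟩, hxW, hWV⟩ :=
      X.isBasis_affineOpens.exists_subset_of_mem_open hx V.isOpen
    exact TopologicalSpace.Opens.mem_iSup.mpr ⟨⟨W, ⟨⟨x, hxW⟩⟩, hW, hWV⟩, hxW⟩
  have hcompat : TopCat.Presheaf.IsCompatible X.sheaf.1 (fun i : I => i.1) sf := by
    intro i j
    -- By irreducibility the overlap is nonempty, so agreement there can be tested in the function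
    -- field.
    have : Nonempty (i.1 ⊓ j.1 : X.Opens) := by
      obtain ⟨x, hx⟩ := nonempty_preirreducible_inter i.1.isOpen j.1.isOpen
        (Set.nonempty_coe_sort.mp (hI i)) (Set.nonempty_coe_sort.mp (hI j))
      exact ⟨⟨x, hx⟩⟩
    apply X.germToFunctionField_injective (i.1 ⊓ j.1)
    refine (germToFunctionField_res (U := i.1) (V := i.1 ⊓ j.1) inf_le_left (sf i)).trans
      (Eq.trans ?_ (germToFunctionField_res (U := j.1) (V := i.1 ⊓ j.1) inf_le_right (sf j)).symm)
    rw [← hsf, ← hsf]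
  obtain ⟨s, hs, -⟩ := X.sheaf.existsUnique_gluing' (fun i : I => i.1) V
    (fun i => homOfLE i.2.2.2) hcover sf hcompat
  obtain ⟨x, hx⟩ := ‹Nonempty V›
  obtain ⟨_, ⟨W, hW, rfl⟩, hxW, hWV⟩ :=
    X.isBasis_affineOpens.exists_subset_of_mem_open hx V.isOpen
  let i : I := ⟨W, ⟨⟨x, hxW⟩⟩, hW, hWV⟩
  refine ⟨s, ?_⟩
  rw [hsf i]
  refine Eq.trans ?_ (germToFunctionField_res (U := V) i.2.2.2 s)
  congr 1
  exact (hs i).symm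

end AlgebraicGeometry.Scheme

/-! ### `p^{-e}`-linear maps on integral schemes and on their function fields -/

/-- The stalk at `π (genericPoint Y)` is the function field of X only through a propositional
equality of points. Assuming `IsField` avoids transporting along it. -/
theorem PInvLinearMap.exists_extension_of_isField {p e : ℕ} [Fact p.Prime] {K L : Type u}
    [CommRing K] [Field L] (hK : IsField K) [CharP K p] (φ : K →+* L) (hφ : φ.IsSeparableExt)
    (ψ : PInvLinearMap p e K) :
    ∃ Ψ : PInvLinearMap p e L, ∀ k, Ψ (φ k) = φ (ψ k) := by
  let := hK.toField
  let := φ.toAlgebra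
  have : Algebra.IsSeparable K L := hφ
  exact exists_extension_of_isSeparable ψ

/-- Denominators of extensions, for a fraction field `K` which is not bundled as a field. -/
theorem PInvLinearMap.exists_denominator_of_isField {p e : ℕ} [Fact p.Prime] {A B K L : Type u}
    [CommRing A] [IsDomain A] [CommRing B] [IsDomain B] [CommRing K] [Field L] [Algebra A B]
    [Algebra A K] [IsFractionRing A K] [Algebra B L] [IsFractionRing B L] [Module.Finite A B]
    (hK : IsField K) [CharP K p] (φ : K →+* L) (hφ : φ.IsSeparableExt)
    (hcomm : ∀ a, φ (algebraMap A K a) = algebraMap B L (algebraMap A B a))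
    (Ψ : PInvLinearMap p e L)
    (hΨ : ∀ a, ∃ a', Ψ (φ (algebraMap A K a)) = φ (algebraMap A K a')) :
    ∃ d : B, d ≠ 0 ∧ ∀ b, ∃ b', Ψ (algebraMap B L (d * b)) = algebraMap B L b' := by
  let := hK.toField
  let := φ.toAlgebra
  let : Algebra A L := (φ.comp (algebraMap A K)).toAlgebra
  have : IsScalarTower A K L := .of_algebraMap_eq fun _ => rfl
  have : IsScalarTower A B L := .of_algebraMap_eq hcomm
  have : Algebra.IsSeparable K L := hφ
  have : ExpChar K p := ExpChar.prime Fact.out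
  exact exists_denominator (A := A) (K := K) (Fact.out : p.Prime).ne_zero Ψ hΨ

/-- The same denominator works after localization, because Ψ(d b / c) = c^{-1} Ψ(d c^{p^e - 1} b).
-/
theorem PInvLinearMap.exists_map_algebraMap_of_isLocalization {p e : ℕ} {B S L : Type u}
    [CommRing B] [CommRing S] [Field L] [Algebra B S] [Algebra B L] [Algebra S L]
    [IsScalarTower B S L] (M : Submonoid B) [IsLocalization M S] (hp : p ≠ 0)
    (Ψ : PInvLinearMap p e L) {d : B}
    (hd : ∀ b, ∃ b', Ψ (algebraMap B L (d * b)) = algebraMap B L b') (s : S) :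
    ∃ s', Ψ (algebraMap S L (algebraMap B S d * s)) = algebraMap S L s' := by
  obtain ⟨b, c, rfl⟩ := IsLocalization.exists_mk'_eq M s
  obtain ⟨b', hb'⟩ := hd (c ^ (p ^ e - 1) * b)
  have hc : IsUnit (algebraMap B L c) := by
    rw [IsScalarTower.algebraMap_apply B S L]
    exact (IsLocalization.map_units S c).map _
  refine ⟨IsLocalization.mk' S b' c, hc.mul_left_cancel ?_⟩
  rw [← map_pow_mul, IsScalarTower.algebraMap_apply B S L c, ← map_pow, ← map_mul, ← map_mul,
    mul_comm (algebraMap B S c), IsLocalization.mk'_spec, ← IsScalarTower.algebraMap_apply B S L,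
    ← hb', IsScalarTower.algebraMap_apply B S L]
  congr 2
  rw [map_mul, map_mul, map_pow, ← pow_sub_one_mul (pow_ne_zero e hp) (algebraMap B S c),
    mul_assoc, mul_comm (algebraMap B S c), mul_assoc (algebraMap B S d),
    IsLocalization.mk'_spec, mul_left_comm]

namespace PInvLinearMapScheme

open AlgebraicGeometry.Scheme

variable {p e : ℕ} {X Y : Scheme.{u}}

theorem stalk_stalkSpecializes (ψ : PInvLinearMapScheme p e X) {x x' : X} (h : x ⤳ x')
    (s : X.presheaf.stalk x') :
    ψ.stalk x ((X.presheaf.stalkSpecializes h).hom s) =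
      (X.presheaf.stalkSpecializes h).hom (ψ.stalk x' s) := by
  obtain ⟨U, hU, a, rfl⟩ := X.presheaf.exists_germ_eq s
  have hg : ∀ c : Γ(X, U), (X.presheaf.stalkSpecializes h).hom ((X.presheaf.germ U x' hU).hom c) =
      (X.presheaf.germ U x (h.mem_open U.isOpen hU)).hom c :=
    fun c => congr($(X.presheaf.germ_stalkSpecializes hU h).hom c)
  erw [stalk_germ, hg, hg, stalk_germ]

/-- Writing a / b = b^{-p^e} (b^{p^e - 1} a) shows that the stalk at x determines ψ on the function
field, and sections on nonempty opens embed there. -/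
theorem stalk_ne_zero [IsIntegral X] {ψ : PInvLinearMapScheme p e X} (hp : p ≠ 0)
    (hψ : ψ ≠ 0) (x : X) : ψ.stalk x ≠ 0 := by
  intro hx
  apply hψ
  have hη : genericPoint X ⤳ x := (genericPoint_spec X).specializes trivial
  have h0 : ∀ f, ψ.stalk (genericPoint X) f = 0 := by
    intro f
    obtain ⟨a, b, hb, rfl⟩ := IsFractionRing.div_surjective (A := X.presheaf.stalk x)
      (K := X.functionField) f
    have hb0 : algebraMap (X.presheaf.stalk x) X.functionField b ≠ 0 :=
      IsFractionRing.to_map_ne_zero_of_mem_nonZeroDivisors hb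
    have h1 : algebraMap (X.presheaf.stalk x) X.functionField b ^ p ^ e *
        (algebraMap (X.presheaf.stalk x) X.functionField a /
          algebraMap (X.presheaf.stalk x) X.functionField b) =
        algebraMap (X.presheaf.stalk x) X.functionField (b ^ (p ^ e - 1) * a) := by
      rw [map_mul, map_pow, ← pow_sub_one_mul (pow_ne_zero e hp) (algebraMap _ X.functionField b)]
      field_simp
    have h2 := (ψ.stalk (genericPoint X)).map_pow_mul
      (algebraMap (X.presheaf.stalk x) X.functionField b)
      (algebraMap (X.presheaf.stalk x) X.functionField a /
        algebraMap (X.presheaf.stalk x) X.functionField b)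
    have h3 := ψ.stalk_stalkSpecializes hη (b ^ (p ^ e - 1) * a)
    rw [hx] at h3
    have h4 := (congrArg (ψ.stalk (genericPoint X)) h1).symm.trans h2
    have h5 := (h3.symm.trans h4).symm.trans (map_zero _)
    exact (mul_eq_zero.mp h5).resolve_left hb0
  have happ : ψ.app = fun _ => 0 := by
    funext U
    ext a
    rcases isEmpty_or_nonempty U with hU | hU
    · have : U = ⊥ := by
        ext x
        simpa using fun hx => hU.false ⟨x, hx⟩
      subst this
      exact Subsingleton.elim _ _
    · apply X.germToFunctionField_injective U
      rw [← ψ.stalk_germ, h0]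
      exact (map_zero _).symm
  cases ψ
  cases happ
  rfl

theorem stalk_stalkMap {π : Y ⟶ X} {ψ : PInvLinearMapScheme p e X}
    {ψY : PInvLinearMapScheme p e Y} (h : Extends π ψ ψY) (y : Y) (s : X.presheaf.stalk (π y)) :
    ψY.stalk y ((π.stalkMap y).hom s) = (π.stalkMap y).hom (ψ.stalk (π y) s) := by
  obtain ⟨U, hU, a, rfl⟩ := X.presheaf.exists_germ_eq s
  have hg : ∀ c : Γ(X, U), (π.stalkMap y).hom ((X.presheaf.germ U (π y) hU).hom c) =
      (Y.presheaf.germ (π ⁻¹ᵁ U) y hU).hom ((π.app U).hom c) :=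
    fun c => Scheme.Hom.germ_stalkMap_apply π U _ hU c
  refine (congrArg (ψY.stalk y) (hg a)).trans ((ψY.stalk_germ (x := y) hU _).trans ?_)
  rw [h, ← hg]
  exact congrArg _ (ψ.stalk_germ hU a).symm

/-- A `p^{-e}`-linear map on the function field which maps regular functions to regular functions
comes from the scheme. -/
theorem exists_of_functionField [IsIntegral X] (Ψ : PInvLinearMap p e X.functionField)
    (hΨ : ∀ (U : X.Opens) [Nonempty U] (a : Γ(X, U)), ∃ b,
      Ψ (X.germToFunctionField U a) = X.germToFunctionField U b) :
    ∃ ψ : PInvLinearMapScheme p e X, ∀ (U : X.Opens) [Nonempty U] (a : Γ(X, U)),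
      X.germToFunctionField U (ψ.app U a) = Ψ (X.germToFunctionField U a) := by
  have hex : ∀ U : X.Opens, ∃ f : PInvLinearMap p e Γ(X, U), ∀ [Nonempty U] (a : Γ(X, U)),
      X.germToFunctionField U (f a) = Ψ (X.germToFunctionField U a) := by
    intro U
    rcases isEmpty_or_nonempty U with hU | hU
    -- The empty open has no germ to the function field, so it is handled separately, by the zero
    -- map.
    · exact ⟨0, fun {h} => (hU.false h.some).elim⟩
    · choose f hf using hΨ U
      have hinj := X.germToFunctionField_injective U
      refine ⟨{ toFun := f, map_zero' := ?_, map_add' := ?_, map_pow_mul' := ?_ }, ?_⟩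
      · apply hinj
        rw [← hf, map_zero, map_zero]
      · intro a b
        apply hinj
        rw [← hf, map_add, map_add, map_add, hf, hf]
      · intro r a
        apply hinj
        rw [← hf, map_mul, map_pow, PInvLinearMap.map_pow_mul, hf, map_mul]
      · exact fun a => (hf a).symm
  choose f hf using hex
  refine ⟨{ app := f, app_res := ?_ }, fun U _ a => hf U a⟩
  intro U V h a
  rcases isEmpty_or_nonempty V with hV | hV
  · have : Subsingleton Γ(X, V) := by
      have : V = ⊥ := by
        ext x
        simpa using fun hx => hV.false ⟨x, hx⟩
      subst this
      infer_instance
    exact Subsingleton.elim _ _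
  · have : Nonempty U := hV.map (Set.inclusion h)
    apply X.germToFunctionField_injective V
    rw [hf]
    erw [germToFunctionField_res h, germToFunctionField_res h]
    rw [hf]

end PInvLinearMapScheme

/-! ### From the function field of Y to the global statements. -/

namespace PInvLinearMapScheme

open AlgebraicGeometry.Scheme

variable {p e : ℕ} {X Y : Scheme.{u}}

theorem algebraMap_stalkMap [IrreducibleSpace Y] (π : Y ⟶ X) (y : Y)
    (r : X.presheaf.stalk (π y)) :
    algebraMap (Y.presheaf.stalk y) Y.functionField ((π.stalkMap y).hom r) =
      (π.stalkMap (genericPoint Y)).hom ((X.presheaf.stalkSpecializes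
        (((genericPoint_spec Y).specializes trivial).map π.continuous)).hom r) :=
  (Scheme.Hom.stalkSpecializes_stalkMap_apply π _ _ ((genericPoint_spec Y).specializes trivial)
    r).symm

/-- Extensions of `ψ` to the function field of `Y` are compatible with `ψ` at all points. -/
theorem map_algebraMap_stalkMap [IsIntegral Y] {π : Y ⟶ X} {ψ : PInvLinearMapScheme p e X}
    {Ψ : PInvLinearMap p e Y.functionField}
    (hΨ : ∀ r, Ψ ((π.stalkMap (genericPoint Y)).hom r) =
      (π.stalkMap (genericPoint Y)).hom (ψ.stalk (π (genericPoint Y)) r))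
    (y : Y) (r : X.presheaf.stalk (π y)) :
    Ψ (algebraMap (Y.presheaf.stalk y) Y.functionField ((π.stalkMap y).hom r)) =
      algebraMap (Y.presheaf.stalk y) Y.functionField
        ((π.stalkMap y).hom (ψ.stalk (π y) r)) := by
  rw [algebraMap_stalkMap, hΨ, stalk_stalkSpecializes, algebraMap_stalkMap]

theorem germToFunctionField_app [IrreducibleSpace Y] (π : Y ⟶ X) (U : X.Opens)
    [Nonempty (π ⁻¹ᵁ U)] (hU : genericPoint Y ∈ π ⁻¹ᵁ U) (a : Γ(X, U)) :
    Y.germToFunctionField (π ⁻¹ᵁ U) ((π.app U).hom a) =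
      (π.stalkMap (genericPoint Y)).hom ((X.presheaf.germ U (π (genericPoint Y)) hU).hom a) :=
  (Scheme.Hom.germ_stalkMap_apply π U _ hU a).symm

theorem isFractionRing_stalk_of_eq [IsIntegral X] {x : X} (hx : x = genericPoint X)
    {U : X.Opens} (hU : IsAffineOpen U) (hxU : x ∈ U) :
    letI := (X.presheaf.germ U x hxU).hom.toAlgebra
    IsFractionRing Γ(X, U) (X.presheaf.stalk x) := by
  subst hx
  have : Nonempty U := ⟨⟨_, hxU⟩⟩
  exact functionField_isFractionRing_of_isAffineOpen X U hU

theorem exists_denominator_stalk [Fact p.Prime] [IsIntegral X] [IsIntegral Y] {π : Y ⟶ X}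
    [IsFinite π] [Surjective π] (hsep : IsSeparableMorphism π)
    [CharP (X.presheaf.stalk (π (genericPoint Y))) p] {ψ : PInvLinearMapScheme p e X}
    {Ψ : PInvLinearMap p e Y.functionField}
    (hΨ : ∀ r, Ψ ((π.stalkMap (genericPoint Y)).hom r) =
      (π.stalkMap (genericPoint Y)).hom (ψ.stalk (π (genericPoint Y)) r)) (y : Y) :
    ∃ d : Y.presheaf.stalk y, d ≠ 0 ∧ ∀ s, ∃ s',
      Ψ (algebraMap (Y.presheaf.stalk y) Y.functionField (d * s)) =
        algebraMap (Y.presheaf.stalk y) Y.functionField s' := by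
  obtain ⟨_, ⟨U, hU, rfl⟩, hyU, -⟩ :=
    X.isBasis_affineOpens.exists_subset_of_mem_open (Set.mem_univ (π y)) isOpen_univ
  have hV : IsAffineOpen (π ⁻¹ᵁ U) := IsAffineOpen.preimage hU π
  have : Nonempty U := ⟨⟨_, hyU⟩⟩
  have : Nonempty (π ⁻¹ᵁ U) := ⟨⟨y, hyU⟩⟩
  have hη : genericPoint Y ∈ π ⁻¹ᵁ U :=
    ((genericPoint_spec Y).mem_open_set_iff (π ⁻¹ᵁ U).isOpen).mpr ⟨y, trivial, hyU⟩
  let := (π.app U).hom.toAlgebra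
  have : Module.Finite Γ(X, U) Γ(Y, π ⁻¹ᵁ U) := π.finite_app U hU
  let := (X.presheaf.germ U (π (genericPoint Y)) hη).hom.toAlgebra
  have := isFractionRing_stalk_of_eq (genericPoint_map_of_surjective π) hU hη
  have := functionField_isFractionRing_of_isAffineOpen Y _ hV
  obtain ⟨d, hd0, hd⟩ := PInvLinearMap.exists_denominator_of_isField (A := Γ(X, U))
    (B := Γ(Y, π ⁻¹ᵁ U)) (isField_stalk_map_genericPoint π) (π.stalkMap (genericPoint Y)).hom hsep
    (fun a => (germToFunctionField_app π U hη a).symm) Ψ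
    (fun a => ⟨ψ.app U a, by
      rw [hΨ]
      exact congrArg _ (ψ.stalk_germ hη a)⟩)
  let := TopCat.Presheaf.algebra_section_stalk Y.presheaf (⟨y, hyU⟩ : (π ⁻¹ᵁ U : Y.Opens))
  have := hV.isLocalization_stalk ⟨y, hyU⟩
  have := functionField_isScalarTower Y (π ⁻¹ᵁ U) ⟨y, hyU⟩
  refine ⟨algebraMap Γ(Y, π ⁻¹ᵁ U) (Y.presheaf.stalk y) d, ?_,
    PInvLinearMap.exists_map_algebraMap_of_isLocalization
      (hV.primeIdealOf ⟨y, hyU⟩).asIdeal.primeCompl (Fact.out : p.Prime).ne_zero Ψ hd⟩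
  exact (map_ne_zero_iff _ (germ_injective_of_isIntegral Y y hyU)).mpr hd0

/-- The stalk of ψY at the generic point plays the role of Ψ in the local order formula, which is
then divided by p^e - 1, nonzero because e > 0. -/
theorem divisor_eq_of_extends [Fact p.Prime] [IsIntegral X] [IsIntegral Y]
    [IsLocallyNoetherian X] [IsLocallyNoetherian Y]
    (hX : ∀ x : X, IsIntegrallyClosed (X.presheaf.stalk x))
    (hY : ∀ y : Y, IsIntegrallyClosed (Y.presheaf.stalk y))
    (hchar : ∀ x : X, CharP (X.presheaf.stalk x) p) {π : Y ⟶ X} [IsFinite π] [Surjective π]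
    (htame : IsTamelyRamifiedInCodimOne p π) (he : 0 < e) {ψ : PInvLinearMapScheme p e X}
    (hψ : ψ ≠ 0) {ψY : PInvLinearMapScheme p e Y} (h : Extends π ψ ψY) :
    ψY.divisor = QDivisor.pullback π ψ.divisor - ramificationDivisor π := by
  funext y
  have hp : p.Prime := Fact.out
  have hπy : Order.coheight (π y.1) = 1 := (coheight_map_of_isFinite hX π y.1).trans y.2
  have := isDiscreteValuationRing_stalk (π y.1) hπy
  have := isDiscreteValuationRing_stalk y.1 y.2
  have := hchar (π y.1)
  have key := (htame y).ord_eq Y.functionField (ψY.stalk (genericPoint Y)) (ψ.stalk (π y.1))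
    (stalk_ne_zero hp.ne_zero hψ _) (ψY.stalk y.1)
    (fun s => ψY.stalk_stalkSpecializes ((genericPoint_spec Y).specializes trivial) s)
    (stalk_stalkMap h y.1)
  have hq : ((p : ℚ) ^ e - 1) ≠ 0 :=
    sub_ne_zero.mpr (one_lt_pow₀ (by exact_mod_cast hp.one_lt) he.ne').ne'
  have key' : ((ψY.stalk y.1).ord.toNat : ℚ) =
      ramificationIndex (π.stalkMap y.1).hom * (ψ.stalk (π y.1)).ord.toNat -
        ((p : ℚ) ^ e - 1) * (ramificationIndex (π.stalkMap y.1).hom - 1) := by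
    exact_mod_cast congrArg (Int.cast : ℤ → ℚ) key
  simp only [Pi.sub_apply, QDivisor.pullback, dif_pos hπy, divisor, ramificationDivisor, key']
  field_simp

/-- At each codimension one point, clearing p^e - 1 from the divisor inequality gives exactly the
integer inequality under which Ψ preserves the stalk. Normality of Y then passes from these stalks
to all sections. -/
theorem exists_extends [Fact p.Prime] [IsIntegral X] [IsIntegral Y]
    [IsLocallyNoetherian X] [IsLocallyNoetherian Y]
    (hX : ∀ x : X, IsIntegrallyClosed (X.presheaf.stalk x))
    (hY : ∀ y : Y, IsIntegrallyClosed (Y.presheaf.stalk y))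
    (hchar : ∀ x : X, CharP (X.presheaf.stalk x) p) {π : Y ⟶ X} [IsFinite π] [Surjective π]
    (hsep : IsSeparableMorphism π) (htame : IsTamelyRamifiedInCodimOne p π) (he : 0 < e)
    {ψ : PInvLinearMapScheme p e X} (hψ : ψ ≠ 0)
    (hle : ramificationDivisor π ≤ QDivisor.pullback π ψ.divisor) :
    ∃ ψY : PInvLinearMapScheme p e Y, Extends π ψ ψY := by
  have hp : p.Prime := Fact.out
  have := hchar (π (genericPoint Y))
  obtain ⟨Ψ, hΨ⟩ := PInvLinearMap.exists_extension_of_isField (L := Y.functionField)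
    (isField_stalk_map_genericPoint π) (π.stalkMap (genericPoint Y)).hom hsep
    (ψ.stalk (π (genericPoint Y)))
  have hstalk : ∀ y : Y, Order.coheight y = 1 → ∀ s, ∃ s',
      Ψ (algebraMap (Y.presheaf.stalk y) Y.functionField s) =
        algebraMap (Y.presheaf.stalk y) Y.functionField s' := by
    intro y hy
    have hπy : Order.coheight (π y) = 1 := (coheight_map_of_isFinite hX π y).trans hy
    have := isDiscreteValuationRing_stalk (π y) hπy
    have := isDiscreteValuationRing_stalk y hy
    have := hchar (π y)
    refine (htame ⟨y, hy⟩).exists_map_algebraMap_eq Ψ (ψ.stalk (π y))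
      (stalk_ne_zero hp.ne_zero hψ _) (map_algebraMap_stalkMap hΨ y)
      (exists_denominator_stalk hsep hΨ y) ?_
    have hq : (0 : ℚ) < (p : ℚ) ^ e - 1 :=
      sub_pos.mpr (one_lt_pow₀ (by exact_mod_cast hp.one_lt) he.ne')
    have h1 := hle ⟨y, hy⟩
    simp only [QDivisor.pullback, dif_pos hπy, divisor, ramificationDivisor] at h1
    rw [← mul_div_assoc, le_div_iff₀ hq, mul_comm] at h1
    exact_mod_cast h1
  obtain ⟨ψY, hψY⟩ := exists_of_functionField Ψ fun V _ a => by
    refine (exists_germToFunctionField_eq _ V fun W _ hW hWV =>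
      exists_germToFunctionField_eq_of_isAffineOpen hY hW _ fun y hy hco => ?_)
    rw [← algebraMap_germ_eq_germToFunctionField Y (hWV hy)]
    exact hstalk y hco _
  refine ⟨ψY, fun U a => ?_⟩
  rcases isEmpty_or_nonempty (π ⁻¹ᵁ U) with hU | hU
  · have : π ⁻¹ᵁ U = ⊥ := by
      ext x
      simpa using fun hx => hU.false ⟨x, hx⟩
    have : Subsingleton Γ(Y, π ⁻¹ᵁ U) := by
      rw [this]
      infer_instance
    exact Subsingleton.elim _ _
  · have hη : genericPoint Y ∈ π ⁻¹ᵁ U :=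
      ((genericPoint_spec Y).mem_open_set_iff (π ⁻¹ᵁ U).isOpen).mpr
        (by simpa using Set.nonempty_coe_sort.mp hU)
    apply Y.germToFunctionField_injective (π ⁻¹ᵁ U)
    rw [hψY, germToFunctionField_app π U hη, hΨ, germToFunctionField_app π U hη]
    exact congrArg _ (ψ.stalk_germ hη a)

end PInvLinearMapScheme

end

theorem mainTheorem1 {p : ℕ} [Fact p.Prime] {k : Type u} [Field k] [CharP k p]
    (hk : (frobenius k p).Finite)
    {X Y : Scheme.{u}} [IsIntegral X] [IsIntegral Y]
    (sX : X ⟶ Spec (.of k)) (sY : Y ⟶ Spec (.of k))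
    (hX : IsNormalVariety sX) (hY : IsNormalVariety sY)
    (π : Y ⟶ X) (hπ : π ≫ sX = sY) [IsFinite π] [Surjective π]
    (hsep : IsSeparableMorphism π) (htame : IsTamelyRamifiedInCodimOne p π)
    {e : ℕ} (he : 0 < e) (ψ : PInvLinearMapScheme p e X) (hψ : ψ ≠ 0) :
    ((∃ ψY : PInvLinearMapScheme p e Y, PInvLinearMapScheme.Extends π ψ ψY) ↔
      ramificationDivisor π ≤ QDivisor.pullback π ψ.divisor) ∧
    ∀ ψY : PInvLinearMapScheme p e Y, PInvLinearMapScheme.Extends π ψ ψY →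
      ψY.divisor = QDivisor.pullback π ψ.divisor - ramificationDivisor π := by
  have := hX.locallyOfFiniteType
  have := hY.locallyOfFiniteType
  have : IsNoetherianRing (CommRingCat.of k) := inferInstanceAs (IsNoetherianRing k)
  have : IsLocallyNoetherian X := LocallyOfFiniteType.isLocallyNoetherian sX
  have : IsLocallyNoetherian Y := LocallyOfFiniteType.isLocallyNoetherian sY
  have hchar : ∀ x : X, CharP (X.presheaf.stalk x) p := fun x => Scheme.charP_stalk p sX x
  have hdiv : ∀ ψY : PInvLinearMapScheme p e Y, PInvLinearMapScheme.Extends π ψ ψY →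
      ψY.divisor = QDivisor.pullback π ψ.divisor - ramificationDivisor π := fun ψY h =>
    PInvLinearMapScheme.divisor_eq_of_extends hX.normal hY.normal hchar htame he hψ h
  refine ⟨⟨?_, PInvLinearMapScheme.exists_extends hX.normal hY.normal hchar hsep htame he hψ⟩,
    hdiv⟩
  rintro ⟨ψY, h⟩
  -- Necessity: the difference is the divisor of ψY, whose coefficients are nonnegative.
  rw [← sub_nonneg, ← hdiv ψY h]
  intro y
  have hp : (1 : ℚ) ≤ p := by exact_mod_cast (Fact.out : p.Prime).one_le
  exact div_nonneg (Nat.cast_nonneg _) (sub_nonneg.mpr (one_le_pow₀ hp))
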